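/- Let $n\ge 1$ and let $\Omega\subset\mathbb{R}^n$ be open and bounded with $C^1$ boundary (near each boundary point, $\Omega$ is, after a rotation, the region below the graph of a $C^1$ function), with outward unit normal $N$ and surface measure $dS$ on $\partial\Omega$. Let $F=F(x,v,p)\in C^2(\overline\Omega\times\mathbb{R}\times\mathbb{R}^n)$ and $g=g(x,v)\in C^1(\partial\Omega\times\mathbb{R})$, and for $v\in C^1(\overline\Omega)$ put $$E(v)=\int_\Omega F(x,v,\nabla v)\,dV-\int_{\partial\Omega}g(x,v)\,dS .$$ Let $V\subseteq C^1(\overline\Omega)$ and let $\bar v\in V$ be such that for every $\varphi\in C^1(\overline\Omega)$ there is $\delta>0$ with $\bar v+\tau\varphi\in V$ whenever $|\tau|<\delta$ (for example $V=C^1(\overline\Omega)$). Suppose that $\bar v$ is a minimizer of $E$ on $V$, global or local: there is $r>0$ such that $E(\bar v)\le E(v)$ for all $v\in V$ with $\|v-\bar v\|_{C^1(\overline\Omega)}<r$. Write $F_v$, $F_{v_{x_i}}=F_{p_i}$ and $g_v$ for the partial derivatives of $F$ and $g$ evaluated along $\bar v$, i.e. at $(x,\bar v(x),\nabla\bar v(x))$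 and $(x,\bar v(x))$ respectively, and let $F_{\nabla v}=(F_{v_{x_1}},\dots,F_{v_{x_n}})$, a continuous vector field on $\overline\Omega$. Then: 1. The equation $$\sum_{i=1}^n\frac{\partial}{\partial x_i}F_{v_{x_i}}=F_v\quad\text{in }\Omega$$ holds in the sense of distributions, that is, $-\int_\Omega F_{\nabla v}\cdot\nabla\varphi\,dV=\int_\Omega F_v\,\varphi\,dV$ for every $C^1$ function $\varphi$ with compact support in $\Omega$. It holds in the classical sense at every point of $\Omega$ at which the field $F_{\nabla v}$ is differentiable, and also at every point of any open set $U\subseteq\Omega$ on which the partial derivatives $\partial_{x_i}F_{v_{x_i}}$, $1\le i\le n$, all exist and are continuous. If $\bar v\in C^2(\Omega)$, or if $n=1$, then $F_{\nabla v}$ is differentiable in $\Omega$, so that the equation holds classically at every point of $\Omega$. 2. The Neumann-type condition $$\sum_{i=1}^n F_{v_{x_i}}N_i=g_v\quad\text{on }\partial\Omega$$ holds at every point of $\partial\Omega$. -/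

import Mathlib

open MeasureTheory Set Metric
open scoped Gradient

noncomputable section

namespace NaturalBC

/-- Euclidean `n`-space. -/
abbrev E (n : ℕ) : Type := EuclideanSpace ℝ (Fin n)

variable {n : ℕ}

/-- Inside the ball `B(x₀, r)` the set `Ω` is the region lying strictly below the graph of the `C¹`
function `γ` in the direction of the unit vector `e`; here `γ` depends only on the component of the
variable orthogonal to `e`. -/
def IsGraphChart (Ω : Set (E n)) (x₀ e : E n) (γ : E n → ℝ) (r : ℝ) : Prop :=
  ‖e‖ = 1 ∧ ContDiff ℝ 1 γ ∧ (∀ (x : E n) (t : ℝ), γ (x + t • e) = γ x) ∧ 0 < r ∧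
    ∀ x ∈ ball x₀ r, (x ∈ Ω ↔ inner ℝ x e < γ x)

/-- `∂Ω` is of class `C¹`: near each of its points `Ω` is, up to a rotation of the coordinates, the
region below the graph of a `C¹` function. -/
def HasC1Boundary (Ω : Set (E n)) : Prop :=
  ∀ x ∈ frontier Ω, ∃ (e : E n) (γ : E n → ℝ) (r : ℝ), IsGraphChart Ω x e γ r

/-- `ν` is the outward unit normal of `Ω` at the boundary point `x`: the normalised gradient of
the local defining function `y ↦ ⟪y, e⟫ - γ y`, which is negative in `Ω`. -/
def IsOutwardUnitNormal (Ω : Set (E n)) (x ν : E n) : Prop :=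
  ∃ (e : E n) (γ : E n → ℝ) (r : ℝ), IsGraphChart Ω x e γ r ∧
    ν = ‖e - ∇ γ x‖⁻¹ • (e - ∇ γ x)

/-- Outward unit normals exist at all points of a `C¹` boundary. -/
theorem HasC1Boundary.exists_outwardUnitNormal {Ω : Set (E n)} (h : HasC1Boundary Ω)
    {x : E n} (hx : x ∈ frontier Ω) : ∃ ν, IsOutwardUnitNormal Ω x ν := by
  obtain ⟨e, γ, r, hc⟩ := h x hx
  exact ⟨_, e, γ, r, hc, rfl⟩

/-- The surface measure `dS` of `∂Ω`: the `(n-1)`-dimensional Hausdorff measure, normalised to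
agree with Lebesgue measure on `ℝⁿ⁻¹`, restricted to `∂Ω`. -/
def surfaceMeasure (Ω : Set (E n)) : Measure (E n) :=
  (Measure.euclideanHausdorffMeasure (n - 1)).restrict (frontier Ω)

/-- `C¹(Ω̄)`. A function on `Ω̄` is represented by any function on `ℝⁿ` extending it; only the
values on `Ω̄` are ever used. -/
def C1Closure (Ω : Set (E n)) : Set (E n → ℝ) :=
  {v | ContDiffOn ℝ 1 v (closure Ω)}

/-- The gradient `∇v` of `v ∈ C¹(Ω̄)`, on all of `Ω̄`. -/
def grad (Ω : Set (E n)) (v : E n → ℝ) : E n → E n :=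
  gradientWithin v (closure Ω)

/-- `E(v) = ∫_Ω F(x, v, ∇v) dV - ∫_∂Ω g(x, v) dS`. -/
def energy (Ω : Set (E n)) (F : E n × ℝ × E n → ℝ) (g : E n × ℝ → ℝ) (v : E n → ℝ) : ℝ :=
  (∫ x in Ω, F (x, v x, grad Ω v x)) - ∫ x, g (x, v x) ∂(surfaceMeasure Ω)

/-- `u` is a (local) minimizer of the energy on `V`: it minimizes among the members of `V` in
some ball about `u` for the norm of `C¹(Ω̄)`. -/
def IsLocalMinimizer (Ω : Set (E n)) (F : E n × ℝ × E n → ℝ) (g : E n × ℝ → ℝ)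
    (V : Set (E n → ℝ)) (u : E n → ℝ) : Prop :=
  u ∈ V ∧ ∃ r > 0, ∀ v ∈ V,
    (∀ x ∈ closure Ω, |v x - u x| + ‖grad Ω v x - grad Ω u x‖ < r) →
      energy Ω F g u ≤ energy Ω F g v

/-- `F_v(x, v(x), ∇v(x))`. -/
def Fv (Ω : Set (E n)) (F : E n × ℝ × E n → ℝ) (v : E n → ℝ) (x : E n) : ℝ :=
  deriv (fun s : ℝ => F (x, s, grad Ω v x)) (v x)

/-- The vector field `F_{∇v}(x, v(x), ∇v(x))`, whose `i`-th component is `F_{v_{xᵢ}}`. -/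
def Fgrad (Ω : Set (E n)) (F : E n × ℝ × E n → ℝ) (v : E n → ℝ) (x : E n) : E n :=
  ∇ (fun p : E n => F (x, v x, p)) (grad Ω v x)

/-- `g_v(x, v(x))`. -/
def gv (g : E n × ℝ → ℝ) (v : E n → ℝ) (x : E n) : ℝ :=
  deriv (fun s : ℝ => g (x, s)) (v x)

/-- The partial derivative `∂Wᵢ/∂xᵢ` at `x`. -/
def diagPartial (W : E n → E n) (i : Fin n) (x : E n) : ℝ :=
  lineDeriv ℝ (fun y => W y i) x (EuclideanSpace.single i 1)

/-- All the partial derivatives `∂Wᵢ/∂xᵢ` exist at every point of `U` and are continuous there. -/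
def HasContDiagPartialsOn (W : E n → E n) (U : Set (E n)) : Prop :=
  ∀ i : Fin n,
    (∀ x ∈ U, LineDifferentiableAt ℝ (fun y => W y i) x (EuclideanSpace.single i 1)) ∧
      ContinuousOn (diagPartial W i) U

/-- `∑ᵢ ∂Wᵢ/∂xᵢ = f` in the sense of distributions in the open set `Ω`. -/
def WeakDivEq (Ω : Set (E n)) (W : E n → E n) (f : E n → ℝ) : Prop :=
  ∀ φ : E n → ℝ, ContDiff ℝ 1 φ → HasCompactSupport φ → tsupport φ ⊆ Ω →
    -∫ x in Ω, ∑ i, W x i * (∇ φ x) i = ∫ x in Ω, f x * φ x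

end NaturalBC

end

/-!
Let `W = F_∇v` along the minimizer `u` and `f = F_v`. Perturbing `u` by `τ φ` and differentiating
under the integral signs at `τ = 0` gives
`∫_Ω (f φ + W · ∇φ) dV = ∫_∂Ω g_v φ dS` for every `C¹` function `φ`
(`IsLocalMinimizer.integral_eq_integral_frontier`). This uses that `∂Ω` has finite area and that
`Ω̄` has the unique differentiability property, so that gradients on `Ω̄` are additive. Everything
else follows from this identity by a choice of `φ`, with `f`, `W` and `g_v` merely continuous.

In the interior the boundary term disappears, which is the weak equation. Where `W` is
differentiable, a bump function concentrated at scale `ε` turns the weak equation, as `ε → 0`, into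
that of the linearised field, which is the classical equation
(`IsWeakSolution.sum_diagPartial_eq`). Where the partial derivatives `∂W_i/∂x_i` are continuous, one
integrates by parts along lines (`IsWeakSolution.sum_diagPartial_eq_of_hasContDiagPartialsOn`). In
dimension one, the lemma of du Bois-Reymond (`hasDerivAt_of_weak`) makes `W` differentiable.

At a boundary point `x₀` no divergence theorem for `W` is available, as `W` need not be
differentiable. Instead a test function concentrated at `x₀` at scale `ε` is used and both sides are
divided by `ε^(n-1)`. In the limit the domain becomes a half-space and `W` becomes constant, so the
left side tends to `W(x₀) · N` times the integral `c` of the test function over the tangent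
hyperplane (`tendsto_interior_rescaled`). For the right side, no area formula is needed either: the
orthogonal projection of `∂Ω` near `x₀` to the tangent hyperplane does not increase distances, its
inverse is Lipschitz with a constant close to `1`, and it covers a neighbourhood of the origin.
Hence the Hausdorff measure on `∂Ω` is close to Lebesgue measure on the hyperplane
(`map_tangentialCoord_le`, `le_map_tangentialCoord`), and the right side tends to `g_v(x₀) c`
(`tendsto_boundary_rescaled`).
-/

namespace NaturalBC

open Filter Topology

/-! ### Partial derivatives and the first variation -/

section FirstVariation

/-- Continuous functions on a compact set carrying a finite measure are integrable. -/
theorem integrable_of_continuousOn_of_ae_mem {X : Type*} [TopologicalSpace X]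
    [T2Space X] [MeasurableSpace X] [OpensMeasurableSpace X] {μ : Measure X} [IsFiniteMeasure μ]
    {A : Set X} (hA : IsCompact A) (hμ : ∀ᵐ x ∂μ, x ∈ A) {f : X → ℝ} (hf : ContinuousOn f A) :
    Integrable f μ := by
  rw [← Measure.restrict_eq_self_of_ae_mem hμ]
  exact hf.integrableOn_compact hA

variable {X Y : Type*} [NormedAddCommGroup X] [NormedSpace ℝ X] [NormedAddCommGroup Y]
  [NormedSpace ℝ Y]

/-- If `f` is `C¹` on `A × Y`, where `A` is arbitrary, then the partial derivative of `f` in the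
second variable exists on `A × Y`. No unique differentiability of `A` is needed as the second
variable is unconstrained. -/
theorem differentiableAt_slice {A : Set X} {f : X × Y → ℝ} (hf : ContDiffOn ℝ 1 f (A ×ˢ univ))
    {x : X} (hx : x ∈ A) (y : Y) : DifferentiableAt ℝ (fun y ↦ f (x, y)) y := by
  have h1 : DifferentiableWithinAt ℝ f (A ×ˢ univ) (x, y) :=
    hf.differentiableOn (by simp) _ ⟨hx, mem_univ _⟩
  have h2 : HasFDerivWithinAt (fun y : Y ↦ (x, y)) (ContinuousLinearMap.inr ℝ X Y) univ y :=
    (hasFDerivAt_prodMk_right x y).hasFDerivWithinAt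
  have h3 := h1.hasFDerivWithinAt.comp y h2 (fun z _ ↦ ⟨hx, mem_univ _⟩)
  exact (hasFDerivWithinAt_univ.1 h3).differentiableAt

theorem continuousOn_fderiv_slice {A : Set X} {f : X × Y → ℝ}
    (hf : ContDiffOn ℝ 1 f (A ×ˢ univ)) :
    ContinuousOn (fun p : X × Y ↦ fderiv ℝ (fun y ↦ f (p.1, y)) p.2) (A ×ˢ univ) := by
  intro p hp
  obtain ⟨u, hu, -, -, f', hf', hf'c⟩ :=
    (contDiffWithinAt_succ_iff_hasFDerivWithinAt' (n := 0) (by simp)).1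
      (by simpa using hf p hp)
  rw [insert_eq_of_mem hp] at hu
  have key : ∀ q ∈ A ×ˢ (univ : Set Y), q ∈ u →
      fderiv ℝ (fun y ↦ f (q.1, y)) q.2 = (f' q).comp (ContinuousLinearMap.inr ℝ X Y) := by
    intro q hq hqu
    have h2 : HasFDerivWithinAt (fun y : Y ↦ (q.1, y)) (ContinuousLinearMap.inr ℝ X Y) univ q.2 :=
      (hasFDerivAt_prodMk_right q.1 q.2).hasFDerivWithinAt
    have hm : MapsTo (fun y : Y ↦ (q.1, y)) univ (A ×ˢ univ) := fun z _ ↦ ⟨hq.1, mem_univ _⟩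
    have h3 := (hf' q hqu).comp q.2 h2 hm
    exact (hasFDerivWithinAt_univ.1 h3).fderiv
  have hc : ContinuousWithinAt
      (fun q ↦ (f' q).comp (ContinuousLinearMap.inr ℝ X Y)) (A ×ˢ univ) p :=
    hf'c.continuousWithinAt.clm_comp continuousWithinAt_const
  refine hc.congr_of_eventuallyEq ?_ (key p hp (mem_of_mem_nhdsWithin hp hu))
  filter_upwards [hu, self_mem_nhdsWithin] with q hq hq' using key q hq' hq

variable [MeasurableSpace X] [BorelSpace X]

/-- The first variation of an integral functional `w ↦ ∫ f(x, w(x)) dμ`, by differentiation under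
the integral sign. -/
theorem hasDerivAt_integral_perturbation {μ : Measure X} [IsFiniteMeasure μ] {A : Set X}
    (hA : IsCompact A) (hμ : ∀ᵐ x ∂μ, x ∈ A) {f : X × Y → ℝ}
    (hf : ContDiffOn ℝ 1 f (A ×ˢ univ)) {w z : X → Y}
    (hw : ContinuousOn w A) (hz : ContinuousOn z A) :
    HasDerivAt (fun τ : ℝ ↦ ∫ x, f (x, w x + τ • z x) ∂μ)
      (∫ x, fderiv ℝ (fun y ↦ f (x, y)) (w x) (z x) ∂μ) 0 := by
  have hmaps : ContinuousOn (fun p : X × ℝ ↦ (p.1, w p.1 + p.2 • z p.1)) (A ×ˢ Icc (-1) 1) := by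
    have h1 : ContinuousOn (fun p : X × ℝ ↦ w p.1) (A ×ˢ Icc (-1) 1) :=
      hw.comp continuousOn_fst (fun p hp ↦ hp.1)
    have h2 : ContinuousOn (fun p : X × ℝ ↦ z p.1) (A ×ˢ Icc (-1) 1) :=
      hz.comp continuousOn_fst (fun p hp ↦ hp.1)
    exact continuousOn_fst.prodMk (h1.add (continuousOn_snd.smul h2))
  have hD : ContinuousOn (fun p : X × ℝ ↦
      fderiv ℝ (fun y ↦ f (p.1, y)) (w p.1 + p.2 • z p.1) (z p.1)) (A ×ˢ Icc (-1) 1) :=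
    ((continuousOn_fderiv_slice hf).comp hmaps (fun p hp ↦ ⟨hp.1, mem_univ _⟩)).clm_apply
      (hz.comp continuousOn_fst (fun p hp ↦ hp.1))
  obtain ⟨C, hC⟩ := (hA.prod isCompact_Icc).exists_bound_of_continuousOn hD
  have hcont : ∀ τ : ℝ, ContinuousOn (fun x ↦ f (x, w x + τ • z x)) A := fun τ ↦
    hf.continuousOn.comp (by fun_prop) (fun x hx ↦ ⟨hx, mem_univ _⟩)
  have hcont' : ContinuousOn (fun x ↦ fderiv ℝ (fun y ↦ f (x, y)) (w x + (0 : ℝ) • z x) (z x)) A :=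
    hD.comp (f := fun x ↦ (x, (0 : ℝ))) (by fun_prop) (fun x hx ↦ ⟨hx, by simp⟩)
  have := (hasDerivAt_integral_of_dominated_loc_of_deriv_le (μ := μ) (x₀ := (0 : ℝ))
    (F := fun τ x ↦ f (x, w x + τ • z x)) (bound := fun _ ↦ C)
    (F' := fun τ x ↦ fderiv ℝ (fun y ↦ f (x, y)) (w x + τ • z x) (z x))
    (Icc_mem_nhds (a := -1) (b := 1) (by norm_num) (by norm_num))
    (Eventually.of_forall fun τ ↦
      (integrable_of_continuousOn_of_ae_mem hA hμ (hcont τ)).aestronglyMeasurable)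
    (integrable_of_continuousOn_of_ae_mem hA hμ (hcont 0))
    (integrable_of_continuousOn_of_ae_mem hA hμ hcont').aestronglyMeasurable
    (hμ.mono fun x hx τ hτ ↦ hC (x, τ) ⟨hx, hτ⟩) (integrable_const C)
    (hμ.mono fun x hx τ _ ↦ ?_)).2
  · simpa using this
  · have h1 := (differentiableAt_slice hf hx (w x + τ • z x)).hasFDerivAt
    have h2 : HasDerivAt (fun τ : ℝ ↦ w x + τ • z x) (z x) τ := by
      simpa using ((hasDerivAt_id τ).smul_const (z x)).const_add (w x)
    exact h1.comp_hasDerivAt τ h2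

end FirstVariation

/-! ### Defining functions of a `C¹` boundary -/

section DefiningFunction

variable {n : ℕ}

/-- Near `x₀` the set `Ω` is the sublevel set `{h < 0}` of a continuous function `h` vanishing at
`x₀`, normalised so that its gradient at `x₀` is `N`. -/
structure IsDefiningFunction (Ω : Set (E n)) (x₀ N : E n) (h : E n → ℝ) (r : ℝ) : Prop where
  norm_eq_one : ‖N‖ = 1
  continuous : Continuous h
  map_eq_zero : h x₀ = 0
  hasStrictFDerivAt : HasStrictFDerivAt h (innerSL ℝ N) x₀
  pos : 0 < r
  mem_iff : ∀ x ∈ ball x₀ r, (x ∈ Ω ↔ h x < 0)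

theorem eq_zero_of_mem_frontier_of_sublevel {Ω : Set (E n)} (hΩ : IsOpen Ω) {h : E n → ℝ}
    (hc : Continuous h) {x₀ : E n} {r : ℝ} (hr : ∀ x ∈ ball x₀ r, (x ∈ Ω ↔ h x < 0)) {x : E n}
    (hx : x ∈ frontier Ω) (hxr : x ∈ ball x₀ r) : h x = 0 := by
  refine le_antisymm ?_ ?_
  · by_contra! hpos
    have hU : ball x₀ r ∩ {y | 0 < h y} ∈ 𝓝 x :=
      inter_mem (isOpen_ball.mem_nhds hxr) ((isOpen_lt continuous_const hc).mem_nhds hpos)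
    obtain ⟨y, ⟨hy1, hy2⟩, hy3⟩ := mem_closure_iff_nhds.1 (frontier_subset_closure hx) _ hU
    exact lt_asymm hy2 ((hr y hy1).1 hy3)
  · rw [hΩ.frontier_eq] at hx
    exact not_lt.1 fun hlt ↦ hx.2 ((hr x hxr).2 hlt)

/-- The direction `e` of a graph chart is orthogonal to the gradient of the graph function. -/
theorem IsGraphChart.inner_gradient {Ω : Set (E n)} {x₀ e : E n} {γ : E n → ℝ} {r : ℝ}
    (hc : IsGraphChart Ω x₀ e γ r) (x : E n) : inner ℝ (∇ γ x) e = 0 := by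
  have h1 : HasFDerivAt γ (fderiv ℝ γ x) (x + (0 : ℝ) • e) := by
    simpa using (hc.2.1.differentiable (by simp) x).hasFDerivAt
  have h2 : HasDerivAt (fun t : ℝ ↦ x + t • e) e 0 := by
    simpa using ((hasDerivAt_id (0 : ℝ)).smul_const e).const_add x
  have h3 : HasDerivAt (fun t : ℝ ↦ γ (x + t • e)) (fderiv ℝ γ x e) 0 :=
    h1.comp_hasDerivAt (0 : ℝ) h2
  have h4 : HasDerivAt (fun t : ℝ ↦ γ (x + t • e)) 0 0 := by
    simpa only [hc.2.2.1 x] using hasDerivAt_const (0 : ℝ) (γ x)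
  rw [← toDual_gradient] at h3
  simpa using h3.unique h4

/-- The height `⟪y, e⟫ - γ y` over the graph, divided by the norm of its gradient, is a defining
function for the outward unit normal. -/
theorem IsOutwardUnitNormal.exists_isDefiningFunction {Ω : Set (E n)} (hΩ : IsOpen Ω)
    {x₀ N : E n} (hx₀ : x₀ ∈ frontier Ω) (hN : IsOutwardUnitNormal Ω x₀ N) :
    ∃ h r, IsDefiningFunction Ω x₀ N h r := by
  obtain ⟨e, γ, r, hc, rfl⟩ := hN
  have horth := hc.inner_gradient x₀
  obtain ⟨he, hγ, -, hr, hmem⟩ := hc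
  set c : ℝ := ‖e - ∇ γ x₀‖ with hcdef
  have hcpos : 0 < c := by
    refine norm_pos_iff.2 fun h0 ↦ ?_
    have h1 : ∇ γ x₀ = e := (sub_eq_zero.1 h0).symm
    rw [h1, real_inner_self_eq_norm_sq, he] at horth
    norm_num at horth
  have hcont : Continuous fun y : E n ↦ inner ℝ y e - γ y := by
    have := hγ.continuous
    fun_prop
  have hmem' : ∀ x ∈ ball x₀ r, (x ∈ Ω ↔ inner ℝ x e - γ x < 0) := fun x hx ↦ by
    rw [hmem x hx, sub_neg]
  refine ⟨fun y ↦ c⁻¹ * (inner ℝ y e - γ y), r, ?_, continuous_const.mul hcont, ?_, ?_, hr, ?_⟩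
  · rw [norm_smul, norm_inv, norm_norm, ← hcdef, inv_mul_cancel₀ hcpos.ne']
  · rw [eq_zero_of_mem_frontier_of_sublevel hΩ hcont hmem' hx₀ (mem_ball_self hr), mul_zero]
  · have h1 : HasStrictFDerivAt (fun y : E n ↦ inner ℝ y e) (innerSL ℝ e) x₀ := by
      have := (innerSL ℝ e).hasStrictFDerivAt (x := x₀)
      exact this.congr_of_eventuallyEq (Eventually.of_forall fun y ↦ real_inner_comm y e)
    have h2 : HasStrictFDerivAt γ (innerSL ℝ (∇ γ x₀)) x₀ := by
      have := hγ.contDiffAt.hasStrictFDerivAt (x := x₀) (by simp)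
      rw [← toDual_gradient] at this
      exact this
    refine ((h1.sub h2).const_mul c⁻¹).congr_fderiv ?_
    rw [map_smul, map_sub]
  · intro x hx
    rw [hmem' x hx, mul_neg_iff]
    have := inv_pos.2 hcpos
    constructor
    · exact fun h ↦ Or.inl ⟨this, h⟩
    · rintro (h | h)
      · exact h.2
      · exact absurd this h.1.not_gt

variable {Ω : Set (E n)} {x₀ N : E n} {h : E n → ℝ} {r : ℝ}

namespace IsDefiningFunction

theorem eq_zero (hd : IsDefiningFunction Ω x₀ N h r) (hΩ : IsOpen Ω) {x : E n}
    (hx : x ∈ frontier Ω) (hxr : x ∈ ball x₀ r) : h x = 0 :=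
  eq_zero_of_mem_frontier_of_sublevel hΩ hd.continuous hd.mem_iff hx hxr

theorem tendsto_div (hd : IsDefiningFunction Ω x₀ N h r) (y : E n) :
    Tendsto (fun ε : ℝ ↦ ε⁻¹ * h (x₀ + ε • y)) (𝓝[>] 0) (𝓝 (inner ℝ N y)) := by
  have h2 : HasDerivAt (fun t : ℝ ↦ x₀ + t • y) y 0 := by
    simpa using ((hasDerivAt_id (0 : ℝ)).smul_const y).const_add x₀
  have h1 : HasFDerivAt h (innerSL ℝ N) (x₀ + (0 : ℝ) • y) := by
    simpa using hd.hasStrictFDerivAt.hasFDerivAt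
  have h3 := (h1.comp_hasDerivAt (0 : ℝ) h2).tendsto_slope_zero_right
  simpa [hd.map_eq_zero] using h3

theorem eventually_mem_ball (x₀ y : E n) {r : ℝ} (hr : 0 < r) :
    ∀ᶠ ε : ℝ in 𝓝[>] 0, x₀ + ε • y ∈ ball x₀ r := by
  have : Tendsto (fun ε : ℝ ↦ x₀ + ε • y) (𝓝[>] 0) (𝓝 (x₀ + (0 : ℝ) • y)) :=
    (Continuous.tendsto (by fun_prop) 0).mono_left nhdsWithin_le_nhds
  rw [zero_smul, add_zero] at this
  exact this (ball_mem_nhds x₀ hr)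

/-- Rescaled at a boundary point, `Ω` fills the open half-space of inward directions. -/
theorem eventually_mem (hd : IsDefiningFunction Ω x₀ N h r) {y : E n} (hy : inner ℝ N y < 0) :
    ∀ᶠ ε : ℝ in 𝓝[>] 0, x₀ + ε • y ∈ Ω := by
  filter_upwards [(hd.tendsto_div y).eventually_lt_const hy, eventually_mem_ball x₀ y hd.pos,
    self_mem_nhdsWithin] with ε h1 h2 h3
  rw [hd.mem_iff _ h2]
  have := inv_pos.2 (mem_Ioi.1 h3)
  nlinarith

/-- Rescaled at a boundary point, `Ω` leaves the open half-space of outward directions. -/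
theorem eventually_notMem (hd : IsDefiningFunction Ω x₀ N h r) {y : E n} (hy : 0 < inner ℝ N y) :
    ∀ᶠ ε : ℝ in 𝓝[>] 0, x₀ + ε • y ∉ Ω := by
  filter_upwards [(hd.tendsto_div y).eventually_const_lt hy, eventually_mem_ball x₀ y hd.pos,
    self_mem_nhdsWithin] with ε h1 h2 h3
  rw [hd.mem_iff _ h2]
  have := inv_pos.2 (mem_Ioi.1 h3)
  intro h4
  nlinarith

/-- The tangent cone of `Ω` at a boundary point contains an open half-space. -/
theorem uniqueDiffWithinAt (hd : IsDefiningFunction Ω x₀ N h r) (hx₀ : x₀ ∈ frontier Ω) :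
    UniqueDiffWithinAt ℝ Ω x₀ := by
  have hcone : ∀ y : E n, inner ℝ N y < 0 → y ∈ tangentConeAt ℝ Ω x₀ := by
    intro y hy
    have hc : Tendsto (fun ε : ℝ ↦ ε) (𝓝[>] 0) (𝓝 0) := tendsto_id.mono_left nhdsWithin_le_nhds
    refine mem_tangentConeAt_of_seq (𝓝[>] (0 : ℝ)) (fun ε ↦ ε⁻¹) (fun ε ↦ ε • y) ?_
      (hd.eventually_mem hy) ?_
    · simpa using hc.smul_const y
    · refine tendsto_const_nhds.congr' ?_
      filter_upwards [self_mem_nhdsWithin] with ε hε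
      rw [inv_smul_smul₀ (ne_of_gt hε)]
  have hNN : inner ℝ N N = 1 := by rw [real_inner_self_eq_norm_sq, hd.norm_eq_one]; norm_num
  refine ⟨?_, frontier_subset_closure hx₀⟩
  have htop : Submodule.span ℝ (tangentConeAt ℝ Ω x₀) = ⊤ := by
    refine eq_top_iff.2 fun v _ ↦ ?_
    set t : ℝ := |inner ℝ N v| + 1
    have h1 : v - t • N ∈ tangentConeAt ℝ Ω x₀ := by
      refine hcone _ ?_
      rw [inner_sub_right, inner_smul_right, hNN]
      have := le_abs_self (inner ℝ N v)
      simp only [t]; linarith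
    have h2 : -N ∈ tangentConeAt ℝ Ω x₀ := hcone _ (by rw [inner_neg_right, hNN]; norm_num)
    have h3 := Submodule.sub_mem _ (Submodule.subset_span h1)
      (Submodule.smul_mem _ t (Submodule.subset_span h2))
    simpa using h3
  rw [htop]
  exact dense_univ

end IsDefiningFunction

theorem HasC1Boundary.uniqueDiffOn_closure {Ω : Set (E n)} (hΩ : IsOpen Ω)
    (h : HasC1Boundary Ω) : UniqueDiffOn ℝ (closure Ω) := by
  intro x hx
  by_cases hxΩ : x ∈ Ω
  · exact (hΩ.uniqueDiffWithinAt hxΩ).mono subset_closure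
  · have hxf : x ∈ frontier Ω := by rw [hΩ.frontier_eq]; exact ⟨hx, hxΩ⟩
    obtain ⟨N, hN⟩ := h.exists_outwardUnitNormal hxf
    obtain ⟨f, r, hd⟩ := hN.exists_isDefiningFunction hΩ hxf
    exact (hd.uniqueDiffWithinAt hxf).mono subset_closure

end DefiningFunction

/-! ### The surface measure near a boundary point -/

section Surface

variable {m : ℕ}

/-- `T` is a system of Cartesian coordinates of `ℝ^(m+1)` adapted to the unit vector `N`: the first
coordinate is the component along `N`, and the others are Cartesian coordinates of the orthogonal
hyperplane. As `ℝ × ℝᵐ` carries the maximum norm, `T` is not an isometry; preservation of volume and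
Pythagoras' theorem are recorded instead. -/
structure IsNormalCoordinates (N : E (m + 1)) (T : E (m + 1) ≃L[ℝ] ℝ × E m) : Prop where
  measurePreserving : MeasurePreserving T
  fst_apply : ∀ x, (T x).1 = inner ℝ N x
  norm_sq : ∀ x, ‖x‖ ^ 2 = (T x).1 ^ 2 + ‖(T x).2‖ ^ 2

theorem exists_isNormalCoordinates {N : E (m + 1)} (hN : ‖N‖ = 1) :
    ∃ T, IsNormalCoordinates N T := by
  obtain ⟨b, hb⟩ := Orthonormal.exists_orthonormalBasis_extension_of_card_eq
    (𝕜 := ℝ) (E := E (m + 1)) (ι := Fin (m + 1)) (by simp) (v := fun _ ↦ N) (s := {0}) (by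
      rw [orthonormal_iff_ite]
      rintro ⟨i, hi⟩ ⟨j, hj⟩
      obtain rfl := mem_singleton_iff.1 hi
      obtain rfl := mem_singleton_iff.1 hj
      simp [hN])
  have hb0 : b 0 = N := hb 0 rfl
  let T₀ : E (m + 1) ≃L[ℝ] ℝ × (Fin m → ℝ) :=
    (b.repr.toContinuousLinearEquiv.trans (PiLp.continuousLinearEquiv 2 ℝ _)).trans
      (Fin.consEquivL ℝ (fun _ ↦ ℝ)).symm
  let T : E (m + 1) ≃L[ℝ] ℝ × E m :=
    T₀.trans ((ContinuousLinearEquiv.refl ℝ ℝ).prodCongr (PiLp.continuousLinearEquiv 2 ℝ _).symm)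
  have hT1 : ∀ x, (T x).1 = b.repr x 0 := fun x ↦ rfl
  have hT2 : ∀ x i, (T x).2 i = b.repr x i.succ := fun x i ↦ rfl
  refine ⟨T, ?_, fun x ↦ ?_, fun x ↦ ?_⟩
  · have h1 : MeasurePreserving b.repr := b.measurePreserving_repr
    have h2 := PiLp.volume_preserving_ofLp (Fin (m + 1))
    have h3 := volume_preserving_piFinSuccAbove (fun _ : Fin (m + 1) ↦ ℝ) 0
    have h4 := (MeasurePreserving.id (volume : Measure ℝ)).prod (PiLp.volume_preserving_toLp (Fin m))
    have h5 : ⇑T = Prod.map id (WithLp.toLp 2) ∘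
        MeasurableEquiv.piFinSuccAbove (fun _ : Fin (m + 1) ↦ ℝ) 0 ∘ WithLp.ofLp ∘ b.repr := by
      ext x
      · rfl
      · rfl
    rw [h5]
    exact h4.comp (h3.comp (h2.comp h1))
  · rw [hT1, b.repr_apply_apply, hb0]
  · rw [← b.repr.norm_map x, EuclideanSpace.norm_sq_eq, EuclideanSpace.norm_sq_eq,
      Fin.sum_univ_succ]
    simp [hT1, hT2]

variable {Ω : Set (E (m + 1))} {x₀ N : E (m + 1)} {h : E (m + 1) → ℝ} {r : ℝ}
  {T : E (m + 1) ≃L[ℝ] ℝ × E m}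

theorem IsNormalCoordinates.norm_snd_le (hT : IsNormalCoordinates N T) (x : E (m + 1)) :
    ‖(T x).2‖ ≤ ‖x‖ := by
  have := hT.norm_sq x
  exact abs_le_of_sq_le_sq' (by nlinarith [sq_nonneg (T x).1]) (norm_nonneg _) |>.2

theorem IsNormalCoordinates.norm_le (hT : IsNormalCoordinates N T) (x : E (m + 1)) :
    ‖x‖ ≤ |(T x).1| + ‖(T x).2‖ := by
  have := hT.norm_sq x
  refine abs_le_of_sq_le_sq' ?_ (by positivity) |>.2
  have h1 : 0 ≤ |(T x).1| * ‖(T x).2‖ := by positivity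
  nlinarith [sq_abs (T x).1]

/-- The tangential coordinates of a point relative to `x₀`. -/
def tangentialCoord (T : E (m + 1) ≃L[ℝ] ℝ × E m) (x₀ x : E (m + 1)) : E m := (T (x - x₀)).2

@[fun_prop]
theorem continuous_tangentialCoord (T : E (m + 1) ≃L[ℝ] ℝ × E m) (x₀ : E (m + 1)) :
    Continuous (tangentialCoord T x₀) := by
  unfold tangentialCoord; fun_prop

theorem exists_mem_frontier_of_mem_of_notMem {X : Type*} [TopologicalSpace X] {S C : Set X}
    (hC : IsPreconnected C) {a b : X} (ha : a ∈ C) (hb : b ∈ C) (haS : a ∈ S) (hbS : b ∉ S) :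
    ∃ c ∈ C, c ∈ frontier S := by
  by_contra! hne
  have hsub : C ⊆ interior S ∪ (closure S)ᶜ := by
    intro x hx
    by_contra hx'
    rw [mem_union, not_or, mem_compl_iff, not_not] at hx'
    exact hne x hx ⟨hx'.2, hx'.1⟩
  obtain ⟨x, -, hx1, hx2⟩ := hC _ _ isOpen_interior isClosed_closure.isOpen_compl hsub
    ⟨a, ha, (hsub ha).resolve_right fun h ↦ h (subset_closure haS)⟩
    ⟨b, hb, (hsub hb).resolve_left fun h ↦ hbS (interior_subset h)⟩
  exact hx2 (subset_closure (interior_subset hx1))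

/-- Strict differentiability of the defining function at `x₀`, spelled out on a ball. -/
theorem IsDefiningFunction.exists_radius (hd : IsDefiningFunction Ω x₀ N h r) {κ : ℝ}
    (hκ : 0 < κ) : ∃ δ, 0 < δ ∧ δ ≤ r ∧ ∀ x ∈ ball x₀ δ, ∀ z ∈ ball x₀ δ,
      |h x - h z - inner ℝ N (x - z)| ≤ κ * ‖x - z‖ := by
  have h1 := hd.hasStrictFDerivAt.isLittleO.bound hκ
  rw [nhds_prod_eq, ((nhds_basis_ball (x := x₀)).prod_self).eventually_iff] at h1
  obtain ⟨δ, hδ, hb⟩ := h1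
  refine ⟨min δ r, lt_min hδ hd.pos, min_le_right _ _, fun x hx z hz ↦ ?_⟩
  have := hb (x := (x, z)) ⟨ball_subset_ball (min_le_left _ _) hx,
    ball_subset_ball (min_le_left _ _) hz⟩
  simpa using this

/-- Boundary points near `x₀` differ by almost tangential vectors. -/
theorem abs_inner_sub_le_of_mem_frontier (hd : IsDefiningFunction Ω x₀ N h r) (hΩ : IsOpen Ω)
    {κ δ : ℝ} (hδr : δ ≤ r) (hδ : ∀ x ∈ ball x₀ δ, ∀ z ∈ ball x₀ δ,
      |h x - h z - inner ℝ N (x - z)| ≤ κ * ‖x - z‖)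
    {x z : E (m + 1)} (hx : x ∈ frontier Ω ∩ ball x₀ δ) (hz : z ∈ frontier Ω ∩ ball x₀ δ) :
    |inner ℝ N (x - z)| ≤ κ * ‖x - z‖ := by
  have := hδ x hx.2 z hz.2
  rwa [hd.eq_zero hΩ hx.1 (ball_subset_ball hδr hx.2),
    hd.eq_zero hΩ hz.1 (ball_subset_ball hδr hz.2), sub_zero, zero_sub, abs_neg] at this

/-- The tangential coordinates map a neighbourhood of `x₀` in the boundary onto a neighbourhood
of the origin: a short segment in the normal direction crosses the boundary. -/
theorem ball_subset_image_tangentialCoord (hT : IsNormalCoordinates N T)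
    (hd : IsDefiningFunction Ω x₀ N h r) {κ δ : ℝ} (hκ : κ < 1 / 2) (hδ0 : 0 < δ) (hδr : δ ≤ r)
    (hδ : ∀ x ∈ ball x₀ δ, ∀ z ∈ ball x₀ δ, |h x - h z - inner ℝ N (x - z)| ≤ κ * ‖x - z‖) :
    ball 0 (δ / 2) ⊆ tangentialCoord T x₀ '' (frontier Ω ∩ ball x₀ δ) := by
  intro y hy
  rw [mem_ball_zero_iff] at hy
  obtain ⟨ρ, hyρ, hρ⟩ := exists_between hy
  have hρ0 : 0 < ρ := (norm_nonneg y).trans_lt hyρ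
  let p : ℝ → E (m + 1) := fun s ↦ x₀ + T.symm (s, y)
  have hTp : ∀ s, T (p s - x₀) = (s, y) := fun s ↦ by simp [p]
  have hpn : ∀ s, |s| ≤ ρ → ‖p s - x₀‖ < 2 * ρ := fun s hs ↦ by
    have := hT.norm_le (p s - x₀)
    rw [hTp] at this
    simp only at this
    linarith
  have hpball : ∀ s, |s| ≤ ρ → p s ∈ ball x₀ δ := fun s hs ↦ by
    rw [mem_ball_iff_norm]
    linarith [hpn s hs]
  have hpc : Continuous p := by fun_prop
  have happ : ∀ s, |s| ≤ ρ → |h (p s) - s| < ρ := fun s hs ↦ by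
    have h1 := hδ (p s) (hpball s hs) x₀ (mem_ball_self hδ0)
    rw [hd.map_eq_zero, sub_zero, ← hT.fst_apply, hTp] at h1
    have h2 := hpn s hs
    have h3 := mul_le_mul_of_nonneg_right hκ.le (norm_nonneg (p s - x₀))
    simp only at h1
    linarith
  have hneg : p (-ρ) ∈ Ω := by
    rw [hd.mem_iff _ (ball_subset_ball hδr (hpball _ (by rw [abs_neg, abs_of_pos hρ0])))]
    have := (abs_lt.1 (happ (-ρ) (by rw [abs_neg, abs_of_pos hρ0]))).2
    linarith
  have hpos : p ρ ∉ Ω := by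
    rw [hd.mem_iff _ (ball_subset_ball hδr (hpball _ (abs_of_pos hρ0).le))]
    have := (abs_lt.1 (happ ρ (abs_of_pos hρ0).le)).1
    linarith
  obtain ⟨c, ⟨s, hs, rfl⟩, hc⟩ := exists_mem_frontier_of_mem_of_notMem
    ((isPreconnected_Icc (a := -ρ) (b := ρ)).image p hpc.continuousOn)
    (mem_image_of_mem p (left_mem_Icc.2 (by linarith)))
    (mem_image_of_mem p (right_mem_Icc.2 (by linarith))) hneg hpos
  exact ⟨p s, ⟨hc, hpball s (abs_le.2 hs)⟩, by rw [tangentialCoord, hTp]⟩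

theorem lipschitzWith_tangentialCoord (hT : IsNormalCoordinates N T) :
    LipschitzWith 1 (tangentialCoord T x₀) := by
  refine LipschitzWith.of_dist_le_mul fun x z ↦ ?_
  rw [NNReal.coe_one, one_mul, dist_eq_norm, dist_eq_norm]
  have := hT.norm_snd_le (x - z)
  rw [show x - z = (x - x₀) - (z - x₀) by abel, map_sub] at this
  simpa [tangentialCoord] using this

theorem euclideanHausdorffMeasure_image_le {X Y : Type*} [EMetricSpace X] [MeasurableSpace X]
    [BorelSpace X] [EMetricSpace Y] [MeasurableSpace Y] [BorelSpace Y] {f : X → Y} {s : Set X}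
    {K : NNReal} (hf : LipschitzOnWith K f s) (d : ℕ) :
    Measure.euclideanHausdorffMeasure d (f '' s) ≤
      (K : ENNReal) ^ d * Measure.euclideanHausdorffMeasure d s := by
  have := hf.hausdorffMeasure_image_le (d := d) (by positivity)
  rw [ENNReal.rpow_natCast] at this
  simp only [Measure.euclideanHausdorffMeasure_def, Measure.smul_apply, ENNReal.smul_def,
    smul_eq_mul]
  calc _ ≤ _ := mul_le_mul_right this _
    _ = _ := by ring

/-- The tangential coordinates are injective on the boundary near `x₀` with a `K`-Lipschitz inverse,
for any `K ≥ (1 - κ)⁻¹`, hence for `K` close to `1` if `κ` is small; this bounds the surface measure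
from above. -/
theorem map_tangentialCoord_le (hT : IsNormalCoordinates N T)
    (hd : IsDefiningFunction Ω x₀ N h r) (hΩ : IsOpen Ω) {κ δ : ℝ} {K : NNReal}
    (hK : 1 ≤ K * (1 - κ)) (hδr : δ ≤ r)
    (hδ : ∀ x ∈ ball x₀ δ, ∀ z ∈ ball x₀ δ, |h x - h z - inner ℝ N (x - z)| ≤ κ * ‖x - z‖) :
    ((Measure.euclideanHausdorffMeasure m).restrict (frontier Ω ∩ ball x₀ δ)).map
      (tangentialCoord T x₀) ≤ ((K : ENNReal) ^ m) • volume := by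
  set q := tangentialCoord T x₀
  set A := frontier Ω ∩ ball x₀ δ
  have hq : Continuous q := continuous_tangentialCoord T x₀
  have hanti : ∀ x ∈ A, ∀ z ∈ A, dist x z ≤ K * dist (q x) (q z) := by
    intro x hx z hz
    have h1 := abs_inner_sub_le_of_mem_frontier hd hΩ hδr hδ hx hz
    have h2 := hT.norm_le (x - z)
    rw [hT.fst_apply] at h2
    have h3 : q x - q z = (T (x - z)).2 := by
      simp [q, tangentialCoord, map_sub]
    rw [dist_eq_norm, dist_eq_norm, h3]
    have h4 : (1 - κ) * ‖x - z‖ ≤ ‖(T (x - z)).2‖ := by linarith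
    calc ‖x - z‖ ≤ K * (1 - κ) * ‖x - z‖ := le_mul_of_one_le_left (norm_nonneg _) hK
      _ = K * ((1 - κ) * ‖x - z‖) := by ring
      _ ≤ _ := mul_le_mul_of_nonneg_left h4 K.2
  have hinj : InjOn q A := fun x hx z hz hxz ↦ by
    have := hanti x hx z hz
    rw [hxz, dist_self, mul_zero] at this
    exact dist_le_zero.1 this
  refine Measure.le_iff.2 fun B hB ↦ ?_
  rw [Measure.map_apply hq.measurable hB, Measure.restrict_apply (hq.measurable hB)]
  set S := q ⁻¹' B ∩ A
  have hlip : LipschitzOnWith K (Function.invFunOn q A) (q '' S) := by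
    refine LipschitzOnWith.of_dist_le_mul ?_
    rintro _ ⟨x, hx, rfl⟩ _ ⟨z, hz, rfl⟩
    rw [hinj.leftInvOn_invFunOn hx.2, hinj.leftInvOn_invFunOn hz.2]
    exact hanti x hx.2 z hz.2
  have himg : Function.invFunOn q A '' (q '' S) = S :=
    (hinj.leftInvOn_invFunOn.mono inter_subset_right).image_image
  have := euclideanHausdorffMeasure_image_le hlip m
  rw [himg, EuclideanSpace.euclideanHausdorffMeasure_eq_volume] at this
  refine this.trans ?_
  rw [Measure.smul_apply, smul_eq_mul]
  exact mul_le_mul_right (measure_mono (by rintro _ ⟨x, hx, rfl⟩; exact hx.1)) _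

/-- Projecting to the tangent hyperplane does not increase area, and a neighbourhood of the origin
is covered; this bounds the surface measure from below. -/
theorem le_map_tangentialCoord (hT : IsNormalCoordinates N T)
    (hd : IsDefiningFunction Ω x₀ N h r) {κ δ : ℝ} (hκ : κ < 1 / 2) (hδ0 : 0 < δ) (hδr : δ ≤ r)
    (hδ : ∀ x ∈ ball x₀ δ, ∀ z ∈ ball x₀ δ, |h x - h z - inner ℝ N (x - z)| ≤ κ * ‖x - z‖) :
    volume.restrict (ball 0 (δ / 2)) ≤
      ((Measure.euclideanHausdorffMeasure m).restrict (frontier Ω ∩ ball x₀ δ)).map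
        (tangentialCoord T x₀) := by
  set q := tangentialCoord T x₀
  have hq : Continuous q := continuous_tangentialCoord T x₀
  refine Measure.le_iff.2 fun B hB ↦ ?_
  rw [Measure.map_apply hq.measurable hB, Measure.restrict_apply (hq.measurable hB),
    Measure.restrict_apply hB]
  have h1 := euclideanHausdorffMeasure_image_le
    ((lipschitzWith_tangentialCoord (x₀ := x₀) hT).lipschitzOnWith
      (s := q ⁻¹' B ∩ (frontier Ω ∩ ball x₀ δ))) m
  rw [EuclideanSpace.euclideanHausdorffMeasure_eq_volume, ENNReal.coe_one, one_pow, one_mul] at h1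
  refine (measure_mono ?_).trans h1
  rintro y ⟨hyB, hy⟩
  obtain ⟨x, hx, rfl⟩ := ball_subset_image_tangentialCoord hT hd hκ hδ0 hδr hδ hy
  exact ⟨x, ⟨hyB, hx⟩, rfl⟩

/-- The boundary of a bounded open set of class `C¹` has finite surface area. -/
theorem isFiniteMeasure_surfaceMeasure {Ω : Set (E (m + 1))} (hΩo : IsOpen Ω)
    (hΩb : Bornology.IsBounded Ω) (hΩ : HasC1Boundary Ω) :
    IsFiniteMeasure (surfaceMeasure Ω) := by
  have hcomp : IsCompact (frontier Ω) :=
    hΩb.isCompact_closure.of_isClosed_subset isClosed_frontier frontier_subset_closure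
  refine ⟨?_⟩
  rw [surfaceMeasure, Measure.restrict_apply_univ, Nat.add_sub_cancel]
  refine hcomp.measure_lt_top_of_nhdsWithin fun x hx ↦ ?_
  obtain ⟨N, hN⟩ := hΩ.exists_outwardUnitNormal hx
  obtain ⟨f, r, hd⟩ := hN.exists_isDefiningFunction hΩo hx
  obtain ⟨T, hT⟩ := exists_isNormalCoordinates hd.norm_eq_one
  obtain ⟨δ, hδ0, hδr, hδ⟩ := hd.exists_radius (κ := 1 / 2) (by norm_num)
  refine ⟨frontier Ω ∩ ball x δ, inter_mem_nhdsWithin _ (ball_mem_nhds x hδ0), ?_⟩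
  have h1 := map_tangentialCoord_le hT hd hΩo (K := 2) (by norm_num) hδr hδ (ball 0 δ)
  rw [Measure.map_apply (continuous_tangentialCoord T x).measurable measurableSet_ball,
    Measure.restrict_apply
      ((continuous_tangentialCoord T x).measurable measurableSet_ball), inter_eq_right.2] at h1
  · refine h1.trans_lt ?_
    rw [Measure.smul_apply, smul_eq_mul]
    exact ENNReal.mul_lt_top (by simp) measure_ball_lt_top
  · rintro z ⟨-, hz⟩
    rw [mem_preimage, mem_ball_zero_iff]
    exact (hT.norm_snd_le _).trans_lt (mem_ball_iff_norm.1 hz)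

end Surface

/-! ### The Euler-Lagrange identity of a minimizer -/

section EulerLagrange

variable {n : ℕ} {Ω : Set (E n)} {F : E n × ℝ × E n → ℝ} {g : E n × ℝ → ℝ} {u φ : E n → ℝ}

theorem grad_add_smul (hUD : UniqueDiffOn ℝ (closure Ω)) (hu : u ∈ C1Closure Ω)
    (hφ : ContDiff ℝ 1 φ) (τ : ℝ) {x : E n} (hx : x ∈ closure Ω) :
    grad Ω (u + τ • φ) x = grad Ω u x + τ • ∇ φ x := by
  have h1 : DifferentiableWithinAt ℝ u (closure Ω) x := hu.differentiableOn (by simp) x hx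
  have h2 : DifferentiableAt ℝ φ x := hφ.differentiable (by simp) x
  simp only [grad, gradientWithin, gradient]
  rw [fderivWithin_add (hUD x hx) h1 (h2.differentiableWithinAt.const_smul τ),
    fderivWithin_const_smul (hUD x hx) h2.differentiableWithinAt,
    h2.fderivWithin (hUD x hx), map_add, map_smulₛₗ]
  simp

theorem continuousOn_grad (hUD : UniqueDiffOn ℝ (closure Ω)) (hu : u ∈ C1Closure Ω) :
    ContinuousOn (grad Ω u) (closure Ω) :=
  (InnerProductSpace.toDual ℝ (E n)).symm.continuous.comp_continuousOn
    (hu.continuousOn_fderivWithin hUD le_rfl)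

theorem continuous_gradient (hφ : ContDiff ℝ 1 φ) : Continuous (∇ φ) :=
  (InnerProductSpace.toDual ℝ (E n)).symm.continuous.comp (hφ.continuous_fderiv (by simp))

theorem inner_gradient (φ : E n → ℝ) (x y : E n) : inner ℝ (∇ φ x) y = fderiv ℝ φ x y := by
  rw [← toDual_gradient, InnerProductSpace.toDual_apply_apply]

theorem Fv_eq (hF : ContDiffOn ℝ 1 F (closure Ω ×ˢ univ)) {x : E n} (hx : x ∈ closure Ω) :
    Fv Ω F u x = fderiv ℝ (fun y : ℝ × E n ↦ F (x, y)) (u x, grad Ω u x) (1, 0) := by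
  have h1 := (differentiableAt_slice hF hx (u x, grad Ω u x)).hasFDerivAt
  have h2 : HasDerivAt (fun s : ℝ ↦ (s, grad Ω u x)) ((1 : ℝ), (0 : E n)) (u x) :=
    (hasDerivAt_id _).prodMk (hasDerivAt_const _ _)
  exact (h1.comp_hasDerivAt (u x) h2).deriv

theorem inner_Fgrad (hF : ContDiffOn ℝ 1 F (closure Ω ×ˢ univ)) {x : E n} (hx : x ∈ closure Ω)
    (p : E n) : inner ℝ (Fgrad Ω F u x) p =
      fderiv ℝ (fun y : ℝ × E n ↦ F (x, y)) (u x, grad Ω u x) (0, p) := by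
  have h1 := (differentiableAt_slice hF hx (u x, grad Ω u x)).hasFDerivAt
  have h2 : HasFDerivAt (fun p : E n ↦ (u x, p)) (ContinuousLinearMap.inr ℝ ℝ (E n))
      (grad Ω u x) := hasFDerivAt_prodMk_right _ _
  have h3 := (h1.comp (grad Ω u x) h2).fderiv
  rw [Fgrad, inner_gradient]
  exact congrArg (fun L : E n →L[ℝ] ℝ ↦ L p) h3

theorem Fgrad_eq (hF : ContDiffOn ℝ 1 F (closure Ω ×ˢ univ)) {x : E n} (hx : x ∈ closure Ω) :
    Fgrad Ω F u x = (InnerProductSpace.toDual ℝ (E n)).symm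
      ((fderiv ℝ (fun y : ℝ × E n ↦ F (x, y)) (u x, grad Ω u x)).comp
        (ContinuousLinearMap.inr ℝ ℝ (E n))) := by
  refine ext_inner_right ℝ fun p ↦ ?_
  rw [inner_Fgrad hF hx, InnerProductSpace.toDual_symm_apply]
  rfl

theorem continuousOn_fderiv_slice_jet (hUD : UniqueDiffOn ℝ (closure Ω)) (hu : u ∈ C1Closure Ω)
    (hF : ContDiffOn ℝ 1 F (closure Ω ×ˢ univ)) :
    ContinuousOn (fun x ↦ fderiv ℝ (fun y : ℝ × E n ↦ F (x, y)) (u x, grad Ω u x))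
      (closure Ω) :=
  (continuousOn_fderiv_slice hF).comp (f := fun x ↦ (x, (u x, grad Ω u x)))
    (continuousOn_id.prodMk (hu.continuousOn.prodMk (continuousOn_grad hUD hu)))
    (fun _ hx ↦ ⟨hx, mem_univ _⟩)

theorem continuousOn_Fv (hUD : UniqueDiffOn ℝ (closure Ω)) (hu : u ∈ C1Closure Ω)
    (hF : ContDiffOn ℝ 1 F (closure Ω ×ˢ univ)) : ContinuousOn (Fv Ω F u) (closure Ω) :=
  ((continuousOn_fderiv_slice_jet hUD hu hF).clm_apply continuousOn_const).congr
    fun _ hx ↦ Fv_eq hF hx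

theorem continuousOn_Fgrad (hUD : UniqueDiffOn ℝ (closure Ω)) (hu : u ∈ C1Closure Ω)
    (hF : ContDiffOn ℝ 1 F (closure Ω ×ˢ univ)) : ContinuousOn (Fgrad Ω F u) (closure Ω) :=
  ((InnerProductSpace.toDual ℝ (E n)).symm.continuous.comp_continuousOn
    ((continuousOn_fderiv_slice_jet hUD hu hF).clm_comp continuousOn_const)).congr
    fun _ hx ↦ Fgrad_eq hF hx

theorem gv_mul (g : E n × ℝ → ℝ) (u : E n → ℝ) (x : E n) (v : ℝ) :
    gv g u x * v = fderiv ℝ (fun s ↦ g (x, s)) (u x) v := by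
  rw [gv, ← fderiv_apply_one_eq_deriv, mul_comm, ← smul_eq_mul, ← map_smul, smul_eq_mul, mul_one]

theorem continuousOn_gv (hu : u ∈ C1Closure Ω) (hg : ContDiffOn ℝ 1 g (frontier Ω ×ˢ univ)) :
    ContinuousOn (gv g u) (frontier Ω) := by
  have h1 := (continuousOn_fderiv_slice hg).comp (f := fun x ↦ (x, u x))
    (continuousOn_id.prodMk (hu.continuousOn.mono frontier_subset_closure))
    (fun x hx ↦ (⟨hx, mem_univ _⟩ : (x, u x) ∈ frontier Ω ×ˢ (univ : Set ℝ)))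
  refine (h1.clm_apply (continuousOn_const (c := (1 : ℝ)))).congr fun x hx ↦ ?_
  rw [gv, ← fderiv_apply_one_eq_deriv]
  rfl

/-- The vanishing of the first variation at a local minimizer, against test functions that need
not vanish on the boundary. -/
theorem IsLocalMinimizer.integral_eq_integral_frontier (hΩo : IsOpen Ω)
    (hΩb : Bornology.IsBounded Ω) (hUD : UniqueDiffOn ℝ (closure Ω))
    [IsFiniteMeasure (surfaceMeasure Ω)]
    (hF : ContDiffOn ℝ 1 F (closure Ω ×ˢ univ)) (hg : ContDiffOn ℝ 1 g (frontier Ω ×ˢ univ))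
    {V : Set (E n → ℝ)} (hV : V ⊆ C1Closure Ω)
    (hvar : ∀ φ ∈ C1Closure Ω, ∃ δ > 0, ∀ τ : ℝ, |τ| < δ → u + τ • φ ∈ V)
    (hmin : IsLocalMinimizer Ω F g V u) (hφ : ContDiff ℝ 1 φ) :
    ∫ x in Ω, (Fv Ω F u x * φ x + fderiv ℝ φ x (Fgrad Ω F u x)) =
      ∫ x, gv g u x * φ x ∂(surfaceMeasure Ω) := by
  obtain ⟨huV, r, hr, hmin⟩ := hmin
  have hu : u ∈ C1Closure Ω := hV huV
  have hK : IsCompact (closure Ω) := hΩb.isCompact_closure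
  have hKf : IsCompact (frontier Ω) :=
    hK.of_isClosed_subset isClosed_frontier frontier_subset_closure
  have : IsFiniteMeasure (volume.restrict Ω) :=
    ⟨by rw [Measure.restrict_apply_univ]; exact hΩb.measure_lt_top⟩
  have hae : ∀ᵐ x ∂(volume.restrict Ω), x ∈ closure Ω :=
    (ae_restrict_mem hΩo.measurableSet).mono fun x hx ↦ subset_closure hx
  have haef : ∀ᵐ x ∂(surfaceMeasure Ω), x ∈ frontier Ω :=
    ae_restrict_mem isClosed_frontier.measurableSet
  have hd1 := hasDerivAt_integral_perturbation hK hae hF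
    (w := fun x ↦ (u x, grad Ω u x)) (z := fun x ↦ (φ x, ∇ φ x))
    (hu.continuousOn.prodMk (continuousOn_grad hUD hu))
    (hφ.continuous.prodMk (continuous_gradient hφ)).continuousOn
  have hd2 := hasDerivAt_integral_perturbation hKf haef hg (w := u) (z := φ)
    (hu.continuousOn.mono frontier_subset_closure) hφ.continuous.continuousOn
  have hderiv := hd1.sub hd2
  have henergy : ∀ τ : ℝ, energy Ω F g (u + τ • φ) =
      (∫ x in Ω, F (x, (u x, grad Ω u x) + τ • (φ x, ∇ φ x))) -
        ∫ x, g (x, u x + τ • φ x) ∂(surfaceMeasure Ω) := by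
    intro τ
    rw [energy]
    congr 1
    refine setIntegral_congr_fun hΩo.measurableSet fun x hx ↦ ?_
    simp only [grad_add_smul hUD hu hφ τ (subset_closure hx)]
    rfl
  obtain ⟨δ, hδ, hδV⟩ := hvar φ hφ.contDiffOn
  obtain ⟨C, hC⟩ := hK.exists_bound_of_continuousOn
    (f := fun x ↦ |φ x| + ‖∇ φ x‖)
    (hφ.continuous.abs.add (continuous_gradient hφ).norm).continuousOn
  have hlocmin : IsLocalMin (fun τ : ℝ ↦
      (∫ x in Ω, F (x, (u x, grad Ω u x) + τ • (φ x, ∇ φ x))) -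
        ∫ x, g (x, u x + τ • φ x) ∂(surfaceMeasure Ω)) 0 := by
    have hlim : Tendsto (fun τ : ℝ ↦ |τ| * C) (𝓝 0) (𝓝 0) := by
      have : Tendsto (fun τ : ℝ ↦ |τ| * C) (𝓝 0) (𝓝 (|0| * C)) :=
        Continuous.tendsto (by fun_prop) 0
      simpa using this
    filter_upwards [Metric.ball_mem_nhds (0 : ℝ) hδ, hlim.eventually_lt_const hr] with τ h1 h2
    rw [← henergy, ← henergy, zero_smul, add_zero]
    refine hmin _ (hδV τ (by simpa using h1)) fun x hx ↦ ?_
    rw [grad_add_smul hUD hu hφ τ hx]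
    simp only [Pi.add_apply, Pi.smul_apply, add_sub_cancel_left, smul_eq_mul, abs_mul, norm_smul,
      Real.norm_eq_abs]
    rw [← mul_add]
    have := (Real.norm_eq_abs _ ▸ le_abs_self _).trans (hC x hx)
    exact (mul_le_mul_of_nonneg_left this (abs_nonneg τ)).trans_lt h2
  have hzero := hlocmin.hasDerivAt_eq_zero hderiv
  rw [sub_eq_zero] at hzero
  calc _ = _ := setIntegral_congr_fun hΩo.measurableSet fun x hx ↦ ?_
    _ = _ := hzero
    _ = _ := integral_congr_ae (ae_of_all _ fun x ↦ (gv_mul g u x (φ x)).symm)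
  have hx' := subset_closure hx
  simp only [Fv_eq hF hx']
  rw [← inner_gradient, real_inner_comm, inner_Fgrad hF hx', mul_comm, ← smul_eq_mul, ← map_smul,
    ← map_add]
  simp

end EulerLagrange

/-! ### Rescaled test functions -/

section Rescaling

variable {n : ℕ}

theorem integral_rescale (H : E n → ℝ) (x₀ : E n) {ε : ℝ} (hε : 0 < ε) :
    ∫ x, H x = ε ^ n * ∫ y, H (x₀ + ε • y) := by
  rw [Measure.integral_comp_smul volume (fun y ↦ H (x₀ + y)) ε, integral_add_left_eq_self,
    finrank_euclideanSpace_fin, abs_of_pos (by positivity), smul_eq_mul,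
    mul_inv_cancel_left₀ (by positivity)]

/-- The function `ψ` rescaled to the length scale `ε` about `x₀`. -/
noncomputable def rescaled (ψ : E n → ℝ) (x₀ : E n) (ε : ℝ) (x : E n) : ℝ := ψ (ε⁻¹ • (x - x₀))

theorem contDiff_rescaled {ψ : E n → ℝ} (hψ : ContDiff ℝ 1 ψ) (x₀ : E n) (ε : ℝ) :
    ContDiff ℝ 1 (rescaled ψ x₀ ε) := by
  unfold rescaled; fun_prop

theorem fderiv_rescaled {ψ : E n → ℝ} (hψ : ContDiff ℝ 1 ψ) (x₀ : E n) (ε : ℝ) (x v : E n) :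
    fderiv ℝ (rescaled ψ x₀ ε) x v = ε⁻¹ * fderiv ℝ ψ (ε⁻¹ • (x - x₀)) v := by
  have h1 := (hψ.differentiable (by simp) (ε⁻¹ • (x - x₀))).hasFDerivAt
  have h2 : HasFDerivAt (fun x : E n ↦ ε⁻¹ • (x - x₀)) (ε⁻¹ • ContinuousLinearMap.id ℝ (E n)) x :=
    ((hasFDerivAt_id x).sub_const x₀).const_smul ε⁻¹
  have h3 := (h1.comp x h2).fderiv
  change fderiv ℝ (ψ ∘ fun x : E n ↦ ε⁻¹ • (x - x₀)) x v = _
  rw [h3]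
  simp

/-- The functional `(a, p) ↦ ψ(y) a + Dψ(y) p` by which a test function `ψ` enters the weak form of
the Euler-Lagrange equation. -/
noncomputable def testForm (ψ : E n → ℝ) (y : E n) : ℝ × E n →L[ℝ] ℝ :=
  ψ y • ContinuousLinearMap.fst ℝ ℝ (E n) +
    (fderiv ℝ ψ y).comp (ContinuousLinearMap.snd ℝ ℝ (E n))

theorem testForm_apply (ψ : E n → ℝ) (y : E n) (p : ℝ × E n) :
    testForm ψ y p = ψ y * p.1 + fderiv ℝ ψ y p.2 := by
  simp [testForm]

theorem continuous_testForm {ψ : E n → ℝ} (hψ : ContDiff ℝ 1 ψ) : Continuous (testForm ψ) := by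
  have h1 := hψ.continuous
  have h2 := hψ.continuous_fderiv (by simp)
  unfold testForm
  fun_prop

theorem tsupport_testForm_subset (ψ : E n → ℝ) : tsupport (testForm ψ) ⊆ tsupport ψ := by
  refine closure_minimal (fun y hy ↦ ?_) (isClosed_tsupport ψ)
  by_contra h
  refine hy ?_
  rw [testForm, image_eq_zero_of_notMem_tsupport h,
    image_eq_zero_of_notMem_tsupport (fun h' ↦ h (tsupport_fderiv_subset ℝ h'))]
  simp

theorem hasCompactSupport_testForm {ψ : E n → ℝ} (hψ : HasCompactSupport ψ) :
    HasCompactSupport (testForm ψ) :=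
  hψ.of_isClosed_subset (isClosed_tsupport _) (tsupport_testForm_subset ψ)

/-- The weak form tested with a rescaled function, after a change of variables. -/
theorem setIntegral_rescaled {Ω : Set (E n)} (hΩ : MeasurableSet Ω) {ψ : E n → ℝ}
    (hψ : ContDiff ℝ 1 ψ) (f : E n → ℝ) (W : E n → E n) (x₀ : E n) {ε : ℝ} (hε : 0 < ε) :
    ∫ x in Ω, (f x * rescaled ψ x₀ ε x + fderiv ℝ (rescaled ψ x₀ ε) x (W x)) =
      ε ^ n * ∫ y, testForm ψ y
        (Ω.indicator f (x₀ + ε • y), ε⁻¹ • Ω.indicator W (x₀ + ε • y)) := by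
  rw [← integral_indicator hΩ, integral_rescale _ x₀ hε]
  congr 2 with y
  rw [testForm_apply]
  by_cases hy : x₀ + ε • y ∈ Ω
  · simp only [indicator_of_mem hy, fderiv_rescaled hψ, rescaled, add_sub_cancel_left,
      inv_smul_smul₀ hε.ne', map_smul, smul_eq_mul]
    ring
  · simp [indicator_of_notMem hy]

/-- Dominated convergence against a continuous, compactly supported field of functionals. -/
theorem tendsto_integral_clm_apply {X : Type*} [NormedAddCommGroup X] [NormedSpace ℝ X]
    {k : E n → X →L[ℝ] ℝ} (hk : Continuous k) (hkc : HasCompactSupport k) {G : ℝ → E n → X}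
    {G₀ : E n → X} {C : ℝ}
    (hm : ∀ᶠ ε in 𝓝[>] 0, AEStronglyMeasurable (G ε) volume)
    (hb : ∀ᶠ ε in 𝓝[>] 0, ∀ y ∈ tsupport k, ‖G ε y‖ ≤ C)
    (hlim : ∀ᵐ y, Tendsto (fun ε ↦ G ε y) (𝓝[>] 0) (𝓝 (G₀ y))) :
    Tendsto (fun ε ↦ ∫ y, k y (G ε y)) (𝓝[>] 0) (𝓝 (∫ y, k y (G₀ y))) := by
  refine tendsto_integral_filter_of_dominated_convergence (fun y ↦ ‖k y‖ * C) ?_ ?_ ?_ ?_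
  · filter_upwards [hm] with ε h
    exact (ContinuousLinearMap.apply ℝ ℝ).flip.aestronglyMeasurable_comp₂
      hk.aestronglyMeasurable h
  · filter_upwards [hb] with ε h
    refine ae_of_all _ fun y ↦ ?_
    by_cases hy : y ∈ tsupport k
    · exact (k y).le_of_opNorm_le_of_le le_rfl (h y hy)
    · simp [image_eq_zero_of_notMem_tsupport hy]
  · exact (hk.norm.integrable_of_hasCompactSupport hkc.norm).mul_const C
  · filter_upwards [hlim] with y h
    exact ((k y).continuous.tendsto _).comp h

theorem aestronglyMeasurable_indicator_comp {X : Type*} [NormedAddCommGroup X] {Ω : Set (E n)}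
    (hΩ : MeasurableSet Ω) {W : E n → X} (hW : ContinuousOn W Ω) (x₀ : E n) {ε : ℝ} :
    AEStronglyMeasurable (fun y ↦ Ω.indicator W (x₀ + ε • y)) volume := by
  have hc : Continuous fun y : E n ↦ x₀ + ε • y := by fun_prop
  have hΩ' : MeasurableSet ((fun y : E n ↦ x₀ + ε • y) ⁻¹' Ω) := hc.measurable hΩ
  have h1 : ContinuousOn (W ∘ fun y ↦ x₀ + ε • y) ((fun y : E n ↦ x₀ + ε • y) ⁻¹' Ω) :=
    hW.comp hc.continuousOn (mapsTo_preimage _ _)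
  exact (aestronglyMeasurable_indicator_iff hΩ').2 (h1.aestronglyMeasurable hΩ')

/-- The integral of a directional derivative of an integrable function vanishes. -/
theorem integral_lineDeriv_eq_zero {f f' : E n → ℝ} {v : E n} (hf : Integrable f)
    (hf' : Integrable f') (h : ∀ x, HasLineDerivAt ℝ f (f' x) x v) : ∫ x, f' x = 0 := by
  have := integral_bilinear_hasLineDerivAt_right_eq_neg_left_of_integrable (μ := volume)
    (f := fun _ : E n ↦ (1 : ℝ)) (f' := fun _ ↦ 0) (g := f) (g' := f') (v := v)
    (B := ContinuousLinearMap.mul ℝ ℝ) (by simp) (by simpa using hf') (by simpa using hf)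
    (fun x _ ↦ by simpa [HasLineDerivAt] using hasDerivAt_const (0 : ℝ) (1 : ℝ)) (fun x _ ↦ h x)
  simpa using this

theorem integral_fderiv_apply_eq_zero {f : E n → ℝ} (hf : ContDiff ℝ 1 f)
    (hfc : HasCompactSupport f) (v : E n) : ∫ x, fderiv ℝ f x v = 0 := by
  refine integral_lineDeriv_eq_zero (f := f) (v := v)
    (hf.continuous.integrable_of_hasCompactSupport hfc) ?_
    (fun x ↦ (hf.differentiable (by simp) x).hasFDerivAt.hasLineDerivAt v)
  exact ((hf.continuous_fderiv (by simp)).clm_apply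
    continuous_const).integrable_of_hasCompactSupport (hfc.fderiv_apply ℝ v)

end Rescaling

/-! ### The boundary flux -/

section BoundaryFlux

variable {m : ℕ}

/-- A smooth cut-off function on `ℝ`, equal to `1` on `[-3, 3]`. -/
noncomputable def normalBump : ContDiffBump (0 : ℝ) := ⟨3, 4, by norm_num, by norm_num⟩

/-- A bump function on `ℝᵐ`, supported in the ball of radius `2`. -/
noncomputable def standardBump (m : ℕ) : ContDiffBump (0 : E m) := ⟨1, 2, by norm_num, by norm_num⟩

/-- The product of a cut-off in the normal direction and a tangential bump. The cut-off is
constant on a range so wide that, on the rescaled boundary, only the tangential factor is seen. -/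
noncomputable def boundaryTest (T : E (m + 1) ≃L[ℝ] ℝ × E m) (y : E (m + 1)) : ℝ :=
  normalBump (T y).1 * standardBump m (T y).2

theorem boundaryTest_nonneg (T : E (m + 1) ≃L[ℝ] ℝ × E m) (y : E (m + 1)) :
    0 ≤ boundaryTest T y :=
  mul_nonneg normalBump.nonneg (standardBump m).nonneg

theorem contDiff_boundaryTest (T : E (m + 1) ≃L[ℝ] ℝ × E m) : ContDiff ℝ 1 (boundaryTest T) := by
  have h1 : ContDiff ℝ 1 normalBump := normalBump.contDiff
  have h2 : ContDiff ℝ 1 (standardBump m) := (standardBump m).contDiff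
  have h3 : ContDiff ℝ 1 T := T.contDiff
  exact (h1.comp (contDiff_fst.comp h3)).mul (h2.comp (contDiff_snd.comp h3))

theorem integrable_standardBump : Integrable (standardBump m) :=
  (standardBump m).continuous.integrable_of_hasCompactSupport (standardBump m).hasCompactSupport

theorem integral_standardBump_pos : 0 < ∫ y, standardBump m y :=
  (standardBump m).integral_pos

variable {Ω : Set (E (m + 1))} {x₀ N : E (m + 1)} {h : E (m + 1) → ℝ} {r : ℝ}
  {T : E (m + 1) ≃L[ℝ] ℝ × E m}

theorem norm_lt_of_boundaryTest_ne_zero (hT : IsNormalCoordinates N T) {y : E (m + 1)}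
    (hy : boundaryTest T y ≠ 0) : ‖y‖ < 6 := by
  have h1 : (T y).1 ∈ Function.support normalBump := left_ne_zero_of_mul hy
  have h2 : (T y).2 ∈ Function.support (standardBump m) := right_ne_zero_of_mul hy
  rw [ContDiffBump.support_eq, mem_ball_zero_iff] at h1 h2
  have := hT.norm_le y
  simp only [normalBump, standardBump, Real.norm_eq_abs] at h1 h2
  linarith

theorem hasCompactSupport_boundaryTest (hT : IsNormalCoordinates N T) :
    HasCompactSupport (boundaryTest T) :=
  HasCompactSupport.intro (isCompact_closedBall 0 6) fun y hy ↦ by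
    by_contra h0
    exact hy (mem_closedBall_zero_iff.2 (norm_lt_of_boundaryTest_ne_zero hT h0).le)

/-- The divergence theorem in a half-space, for the product of a constant field and the test
function. -/
theorem integral_halfSpace_fderiv (hT : IsNormalCoordinates N T) (a : E (m + 1)) :
    ∫ y, fderiv ℝ (boundaryTest T) y ({y | inner ℝ N y < 0}.indicator (fun _ ↦ a) y) =
      inner ℝ N a * ∫ y, standardBump m y := by
  set χ : ℝ → ℝ := ⇑normalBump
  set ρ : E m → ℝ := ⇑(standardBump m)
  have hχ : ContDiff ℝ 1 χ := normalBump.contDiff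
  have hρ : ContDiff ℝ 1 ρ := (standardBump m).contDiff
  have hχc : HasCompactSupport χ := normalBump.hasCompactSupport
  have hρc : HasCompactSupport ρ := (standardBump m).hasCompactSupport
  let G : ℝ × E m → ℝ := (Iio (0 : ℝ) ×ˢ univ).indicator fun z ↦
    deriv χ z.1 * (ρ z.2 * (T a).1) + χ z.1 * fderiv ℝ ρ z.2 (T a).2
  have hfd : ∀ y, fderiv ℝ (boundaryTest T) y a =
      deriv χ (T y).1 * (ρ (T y).2 * (T a).1) + χ (T y).1 * fderiv ℝ ρ (T y).2 (T a).2 := by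
    intro y
    have hT' : HasFDerivAt T (T : E (m + 1) →L[ℝ] ℝ × E m) y := T.hasFDerivAt
    have h1 := ((hχ.differentiable (by simp) (T y).1).hasFDerivAt).comp y hT'.fst
    have h2 := ((hρ.differentiable (by simp) (T y).2).hasFDerivAt).comp y hT'.snd
    have h3 := (h1.mul h2).fderiv
    change fderiv ℝ ((χ ∘ fun y ↦ (T y).1) * (ρ ∘ fun y ↦ (T y).2)) y a = _
    rw [h3]
    simp only [add_apply, smul_apply, ContinuousLinearMap.comp_apply,
      ContinuousLinearMap.coe_fst', ContinuousLinearMap.coe_snd', Function.comp_apply, smul_eq_mul,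
      ContinuousLinearEquiv.coe_coe, fderiv_eq_smul_deriv]
    ring
  have hG : ∀ y, fderiv ℝ (boundaryTest T) y ({y | inner ℝ N y < 0}.indicator (fun _ ↦ a) y) =
      G (T y) := by
    intro y
    by_cases hy : inner ℝ N y < 0
    · have hy' : T y ∈ Iio (0 : ℝ) ×ˢ (univ : Set (E m)) :=
        ⟨by rw [hT.fst_apply]; exact hy, mem_univ _⟩
      simp only [G, indicator_of_mem hy']
      rw [indicator_of_mem (by exact hy), hfd]
    · have hy' : T y ∉ Iio (0 : ℝ) ×ˢ (univ : Set (E m)) := fun h' ↦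
        hy (by rw [← hT.fst_apply]; exact h'.1)
      simp only [G, indicator_of_notMem hy']
      rw [indicator_of_notMem (by exact hy), map_zero]
  have hi1 : Integrable (deriv χ) :=
    (hχ.continuous_deriv le_rfl).integrable_of_hasCompactSupport hχc.deriv
  have hi2 : Integrable ρ := hρ.continuous.integrable_of_hasCompactSupport hρc
  have hi3 : Integrable χ := hχ.continuous.integrable_of_hasCompactSupport hχc
  have hi4 : Integrable (fun y ↦ fderiv ℝ ρ y (T a).2) :=
    ((hρ.continuous_fderiv (by simp)).clm_apply
      continuous_const).integrable_of_hasCompactSupport (hρc.fderiv_apply ℝ _)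
  have hχ0 : χ 0 = 1 := normalBump.one_of_mem_closedBall (mem_closedBall_self (by
    simp [normalBump]))
  calc _ = ∫ y, G (T y) := integral_congr_ae (ae_of_all _ hG)
    _ = ∫ z, G z :=
      hT.measurePreserving.integral_comp T.toHomeomorph.measurableEmbedding G
    _ = ∫ z in Iio (0 : ℝ) ×ˢ (univ : Set (E m)),
          (deriv χ z.1 * (ρ z.2 * (T a).1) + χ z.1 * fderiv ℝ ρ z.2 (T a).2) :=
      integral_indicator (measurableSet_Iio.prod MeasurableSet.univ)
    _ = _ := ?_
  rw [Measure.volume_eq_prod, integral_add (hi1.mul_prod (hi2.mul_const _)).integrableOn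
    (hi3.mul_prod hi4).integrableOn, setIntegral_prod_mul (deriv χ) (fun y ↦ ρ y * (T a).1),
    setIntegral_prod_mul χ (fun y ↦ fderiv ℝ ρ y (T a).2), setIntegral_univ, setIntegral_univ,
    integral_fderiv_apply_eq_zero hρ hρc, mul_zero, add_zero, ← integral_Iic_eq_integral_Iio,
    HasCompactSupport.integral_Iic_deriv_eq hχ hχc, hχ0, integral_mul_const, hT.fst_apply]
  ring

theorem ae_inner_ne_zero (hT : IsNormalCoordinates N T) : ∀ᵐ y : E (m + 1), inner ℝ N y ≠ 0 := by
  have h1 : volume (({0} : Set ℝ) ×ˢ (univ : Set (E m))) = 0 := by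
    rw [Measure.volume_eq_prod, Measure.prod_prod]; simp
  have h2 := hT.measurePreserving.measure_preimage
    ((measurableSet_singleton (0 : ℝ)).prod (MeasurableSet.univ (α := E m))).nullMeasurableSet
  rw [h1] at h2
  rw [ae_iff]
  refine measure_mono_null (fun y hy ↦ ?_) h2
  rw [mem_ofPred_eq, not_not, ← hT.fst_apply] at hy
  exact ⟨hy, mem_univ _⟩

/-- The interior terms of the weak equation, tested at scale `ε` at a boundary point: in the limit
the domain becomes a half-space and the field becomes constant, so that only the normal flux
survives. -/
theorem tendsto_interior_rescaled (hT : IsNormalCoordinates N T)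
    (hd : IsDefiningFunction Ω x₀ N h r) (hΩo : IsOpen Ω) (hΩb : Bornology.IsBounded Ω)
    (hx₀ : x₀ ∈ frontier Ω) {f : E (m + 1) → ℝ} {W : E (m + 1) → E (m + 1)}
    (hf : ContinuousOn f (closure Ω)) (hW : ContinuousOn W (closure Ω)) :
    Tendsto (fun ε : ℝ ↦ (ε ^ m)⁻¹ * ∫ x in Ω, (f x * rescaled (boundaryTest T) x₀ ε x +
      fderiv ℝ (rescaled (boundaryTest T) x₀ ε) x (W x))) (𝓝[>] 0)
      (𝓝 (inner ℝ N (W x₀) * ∫ y, standardBump m y)) := by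
  have hK : IsCompact (closure Ω) := hΩb.isCompact_closure
  obtain ⟨Cf, hCf⟩ := hK.exists_bound_of_continuousOn hf
  obtain ⟨CW, hCW⟩ := hK.exists_bound_of_continuousOn hW
  have hψ := contDiff_boundaryTest T
  have hCf0 : 0 ≤ Cf := (norm_nonneg _).trans (hCf x₀ (frontier_subset_closure hx₀))
  have hCW0 : 0 ≤ CW := (norm_nonneg _).trans (hCW x₀ (frontier_subset_closure hx₀))
  have hbf : ∀ x, ‖Ω.indicator f x‖ ≤ Cf := fun x ↦ by
    by_cases hx : x ∈ Ω
    · rw [indicator_of_mem hx]; exact hCf x (subset_closure hx)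
    · rw [indicator_of_notMem hx, norm_zero]; exact hCf0
  have hbW : ∀ x, ‖Ω.indicator W x‖ ≤ CW := fun x ↦ by
    by_cases hx : x ∈ Ω
    · rw [indicator_of_mem hx]; exact hCW x (subset_closure hx)
    · rw [indicator_of_notMem hx, norm_zero]; exact hCW0
  have hid : Tendsto (fun ε : ℝ ↦ ε) (𝓝[>] 0) (𝓝 0) := tendsto_id.mono_left nhdsWithin_le_nhds
  have hlim := tendsto_integral_clm_apply (C := max Cf CW) (continuous_testForm hψ)
    (hasCompactSupport_testForm (hasCompactSupport_boundaryTest hT))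
    (G := fun ε y ↦ (ε * Ω.indicator f (x₀ + ε • y), Ω.indicator W (x₀ + ε • y)))
    (G₀ := fun y ↦ (0, {y | inner ℝ N y < 0}.indicator (fun _ ↦ W x₀) y))
    (Eventually.of_forall fun ε ↦ ?_) ?_ ?_
  · have hval : ∫ y, testForm (boundaryTest T) y
        ((0 : ℝ), {y | inner ℝ N y < 0}.indicator (fun _ ↦ W x₀) y) =
        inner ℝ N (W x₀) * ∫ y, standardBump m y := by
      rw [← integral_halfSpace_fderiv hT]
      exact integral_congr_ae (ae_of_all _ fun y ↦ by simp [testForm_apply])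
    rw [hval] at hlim
    refine hlim.congr' ?_
    filter_upwards [self_mem_nhdsWithin] with ε hε
    have hε' : ε ≠ 0 := ne_of_gt hε
    rw [setIntegral_rescaled hΩo.measurableSet hψ f W x₀ hε, pow_succ, ← mul_assoc,
      inv_mul_cancel_left₀ (pow_ne_zero m hε'), ← integral_const_mul]
    refine integral_congr_ae (ae_of_all _ fun y ↦ ?_)
    simp only []
    rw [← smul_eq_mul ε (testForm _ _ _), ← map_smul, Prod.smul_mk, smul_inv_smul₀ hε',
      smul_eq_mul]
  · exact ((aestronglyMeasurable_indicator_comp hΩo.measurableSet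
      (hf.mono subset_closure) x₀).const_mul ε).prodMk
      (aestronglyMeasurable_indicator_comp hΩo.measurableSet (hW.mono subset_closure) x₀)
  · filter_upwards [self_mem_nhdsWithin, hid.eventually_lt_const one_pos] with ε h1 h2 y _
    rw [Prod.norm_def]
    refine max_le_max ?_ (hbW _)
    rw [norm_mul, Real.norm_of_nonneg (le_of_lt h1)]
    exact (mul_le_of_le_one_left (norm_nonneg _) h2.le).trans (hbf _)
  · filter_upwards [ae_inner_ne_zero hT] with y hy
    refine Tendsto.prodMk_nhds ?_ ?_
    · refine squeeze_zero_norm' (a := fun ε ↦ ε * Cf) ?_ (by simpa using hid.mul_const Cf)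
      filter_upwards [self_mem_nhdsWithin] with ε h1
      rw [norm_mul, Real.norm_of_nonneg (le_of_lt h1)]
      exact mul_le_mul_of_nonneg_left (hbf _) (le_of_lt h1)
    · rcases lt_or_gt_of_ne hy with hy | hy
      · have hmem := hd.eventually_mem hy
        rw [indicator_of_mem (by exact hy)]
        have h1 : Tendsto (fun ε : ℝ ↦ x₀ + ε • y) (𝓝[>] 0) (𝓝[closure Ω] x₀) := by
          refine tendsto_nhdsWithin_iff.2 ⟨?_, hmem.mono fun ε hε ↦ subset_closure hε⟩
          simpa using (hid.smul_const y).const_add x₀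
        refine ((hW x₀ (frontier_subset_closure hx₀)).tendsto.comp h1).congr' ?_
        filter_upwards [hmem] with ε hε
        rw [indicator_of_mem hε, Function.comp_apply]
      · rw [indicator_of_notMem (by exact hy.not_gt)]
        refine tendsto_const_nhds.congr' ?_
        filter_upwards [hd.eventually_notMem hy] with ε hε
        rw [indicator_of_notMem hε]

end BoundaryFlux

section BoundaryTerm

variable {m : ℕ} {Ω : Set (E (m + 1))} {x₀ N : E (m + 1)} {h : E (m + 1) → ℝ} {r : ℝ}
  {T : E (m + 1) ≃L[ℝ] ℝ × E m}

/-- On the boundary near `x₀`, which is almost tangential to the hyperplane `N^⊥`, the rescaled test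
function is a function of the tangential coordinates alone. -/
theorem rescaled_boundaryTest_eq (hT : IsNormalCoordinates N T)
    (hd : IsDefiningFunction Ω x₀ N h r) (hΩ : IsOpen Ω) {κ δ : ℝ} (hκ : κ ≤ 1 / 2) (hδ0 : 0 < δ)
    (hδr : δ ≤ r)
    (hδ : ∀ x ∈ ball x₀ δ, ∀ z ∈ ball x₀ δ, |h x - h z - inner ℝ N (x - z)| ≤ κ * ‖x - z‖)
    (hx₀ : x₀ ∈ frontier Ω) {x : E (m + 1)} (hx : x ∈ frontier Ω ∩ ball x₀ δ) {ε : ℝ}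
    (hε : 0 < ε) :
    rescaled (boundaryTest T) x₀ ε x = standardBump m (ε⁻¹ • tangentialCoord T x₀ x) := by
  have h1 := abs_inner_sub_le_of_mem_frontier hd hΩ hδr hδ hx ⟨hx₀, mem_ball_self hδ0⟩
  have h2 := hT.norm_le (x - x₀)
  rw [← hT.fst_apply] at h1
  have h3 : |(T (x - x₀)).1| ≤ ‖tangentialCoord T x₀ x‖ := by
    have := mul_le_mul_of_nonneg_right hκ (norm_nonneg (x - x₀))
    rw [tangentialCoord]
    linarith
  rw [rescaled, boundaryTest, map_smul, Prod.smul_fst, Prod.smul_snd]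
  change _ * standardBump m (ε⁻¹ • tangentialCoord T x₀ x) = _
  by_cases hz : standardBump m (ε⁻¹ • tangentialCoord T x₀ x) = 0
  · rw [hz, mul_zero]
  · have h4 : ε⁻¹ • tangentialCoord T x₀ x ∈ Function.support (standardBump m) := hz
    rw [ContDiffBump.support_eq, mem_ball_zero_iff, norm_smul, norm_inv,
      Real.norm_of_nonneg hε.le] at h4
    rw [normalBump.one_of_mem_closedBall, one_mul]
    rw [mem_closedBall_zero_iff, norm_smul, norm_inv, Real.norm_of_nonneg hε.le, Real.norm_eq_abs]
    have h5 := mul_le_mul_of_nonneg_left h3 (inv_pos.2 hε).le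
    simp only [standardBump, normalBump] at h4 ⊢
    linarith

theorem rescaled_boundaryTest_eq_zero (hT : IsNormalCoordinates N T) {ε δ : ℝ} (hε : 0 < ε)
    (hεδ : 6 * ε ≤ δ) {x : E (m + 1)} (hx : x ∉ ball x₀ δ) :
    rescaled (boundaryTest T) x₀ ε x = 0 := by
  by_contra hne
  have := norm_lt_of_boundaryTest_ne_zero hT hne
  rw [norm_smul, norm_inv, Real.norm_of_nonneg hε.le, inv_mul_lt_iff₀ hε] at this
  refine hx (mem_ball_iff_norm.2 ?_)
  linarith

/-- The surface integral of the rescaled test function lies within a factor close to `1` of the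
integral of the tangential bump over the tangent hyperplane. -/
theorem eventually_surface_integral_bounds (hT : IsNormalCoordinates N T)
    (hd : IsDefiningFunction Ω x₀ N h r) (hΩ : IsOpen Ω) (hx₀ : x₀ ∈ frontier Ω) {θ : ℝ}
    (hθ : 1 < θ) : ∀ᶠ ε : ℝ in 𝓝[>] 0,
      ∫ y, standardBump m y ≤
        (ε ^ m)⁻¹ * ∫ x, rescaled (boundaryTest T) x₀ ε x ∂(surfaceMeasure Ω) ∧
      (ε ^ m)⁻¹ * ∫ x, rescaled (boundaryTest T) x₀ ε x ∂(surfaceMeasure Ω) ≤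
        θ * ∫ y, standardBump m y := by
  obtain ⟨κ, hκ0, hκ2, hκθ⟩ : ∃ κ : ℝ, 0 < κ ∧ κ < 1 / 2 ∧ ((1 - κ)⁻¹) ^ m < θ := by
    have hc : ContinuousAt (fun κ : ℝ ↦ ((1 - κ)⁻¹) ^ m) 0 :=
      ((continuousAt_const.sub continuousAt_id).inv₀ (by norm_num)).pow m
    have h1 : ∀ᶠ κ in 𝓝[>] (0 : ℝ), ((1 - κ)⁻¹) ^ m < θ :=
      (hc.tendsto.eventually_lt_const (by simpa using hθ)).filter_mono nhdsWithin_le_nhds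
    have h2 : ∀ᶠ κ in 𝓝[>] (0 : ℝ), κ < 1 / 2 :=
      (eventually_lt_nhds (by norm_num)).filter_mono nhdsWithin_le_nhds
    obtain ⟨κ, h3, h4, h5⟩ := (h1.and (h2.and self_mem_nhdsWithin)).exists
    exact ⟨κ, h5, h4, h3⟩
  obtain ⟨δ, hδ0, hδr, hδ⟩ := hd.exists_radius hκ0
  have hK0 : 0 ≤ (1 - κ)⁻¹ := inv_nonneg.2 (by linarith)
  set K : NNReal := ⟨(1 - κ)⁻¹, hK0⟩
  have hK : 1 ≤ K * (1 - κ) := (inv_mul_cancel₀ (by linarith : (1 - κ) ≠ 0)).ge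
  set A := frontier Ω ∩ ball x₀ δ
  set q := tangentialCoord T x₀
  have hq : Continuous q := continuous_tangentialCoord T x₀
  have hup := map_tangentialCoord_le hT hd hΩ hK hδr hδ
  have hlo := le_map_tangentialCoord hT hd hκ2 hδ0 hδr hδ
  have hlt : ∀ᶠ ε : ℝ in 𝓝[>] 0, ε < δ / 6 :=
    (eventually_lt_nhds (by positivity)).filter_mono nhdsWithin_le_nhds
  filter_upwards [hlt, self_mem_nhdsWithin] with ε hεδ hε
  rw [mem_Ioi] at hε
  set ρ : E m → ℝ := fun y ↦ standardBump m (ε⁻¹ • y)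
  have hρc : Continuous ρ := (standardBump m).continuous.comp (continuous_const_smul _)
  have hρ0 : ∀ y, 0 ≤ ρ y := fun y ↦ (standardBump m).nonneg
  have hρint : ∫ y, ρ y = ε ^ m * ∫ y, standardBump m y := by
    simp only [ρ]
    rw [Measure.integral_comp_inv_smul_of_nonneg volume (fun y ↦ standardBump m y) hε.le,
      finrank_euclideanSpace_fin, smul_eq_mul]
  have hρi : Integrable ρ := integrable_standardBump.comp_smul (inv_ne_zero hε.ne')
  have hA : ∫ x, rescaled (boundaryTest T) x₀ ε x ∂(surfaceMeasure Ω) =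
      ∫ y, ρ y ∂(((Measure.euclideanHausdorffMeasure m).restrict A).map q) := by
    rw [integral_map hq.aemeasurable hρc.aestronglyMeasurable, surfaceMeasure, Nat.add_sub_cancel]
    have hs : ∀ x ∈ frontier Ω \ A, rescaled (boundaryTest T) x₀ ε x = 0 := fun x hx ↦
      rescaled_boundaryTest_eq_zero hT hε (by linarith) fun hx' ↦ hx.2 ⟨hx.1, hx'⟩
    rw [setIntegral_eq_of_subset_of_forall_sdiff_eq_zero isClosed_frontier.measurableSet
      (inter_subset_left : A ⊆ frontier Ω) hs]
    exact setIntegral_congr_fun (isClosed_frontier.measurableSet.inter measurableSet_ball)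
      fun x hx ↦ rescaled_boundaryTest_eq hT hd hΩ hκ2.le hδ0 hδr hδ hx₀ hx hε
  have hsmul : Integrable ρ (((K : ENNReal) ^ m) • volume) := hρi.smul_measure (by simp)
  have h1 := integral_mono_measure hup (ae_of_all _ hρ0) hsmul
  have h2 := integral_mono_measure hlo (ae_of_all _ hρ0) (hsmul.mono_measure hup)
  have hsupp : ∫ y in ball 0 (δ / 2), ρ y = ∫ y, ρ y := by
    refine setIntegral_eq_integral_of_forall_compl_eq_zero fun y hy ↦ ?_
    by_contra hne
    have h4 : ε⁻¹ • y ∈ Function.support (standardBump m) := hne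
    rw [ContDiffBump.support_eq, mem_ball_zero_iff, norm_smul, norm_inv,
      Real.norm_of_nonneg hε.le, inv_mul_lt_iff₀ hε] at h4
    simp only [standardBump] at h4
    exact hy (mem_ball_zero_iff.2 (by linarith))
  rw [integral_smul_measure, hρint] at h1
  rw [hsupp, hρint] at h2
  have hKm : ((K : ENNReal) ^ m).toReal = ((1 - κ)⁻¹) ^ m := by
    rw [ENNReal.toReal_pow]; rfl
  rw [hKm, smul_eq_mul] at h1
  have hεm : 0 < ε ^ m := pow_pos hε m
  rw [hA, le_inv_mul_iff₀ hεm, inv_mul_le_iff₀ hεm]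
  refine ⟨h2, h1.trans ?_⟩
  have hc := (integral_standardBump_pos (m := m)).le
  calc _ ≤ θ * (ε ^ m * ∫ y, standardBump m y) :=
        mul_le_mul_of_nonneg_right hκθ.le (by positivity)
    _ = _ := by ring

theorem tendsto_surface_rescaled (hT : IsNormalCoordinates N T)
    (hd : IsDefiningFunction Ω x₀ N h r) (hΩ : IsOpen Ω) (hx₀ : x₀ ∈ frontier Ω) :
    Tendsto (fun ε : ℝ ↦ (ε ^ m)⁻¹ * ∫ x, rescaled (boundaryTest T) x₀ ε x ∂(surfaceMeasure Ω))
      (𝓝[>] 0) (𝓝 (∫ y, standardBump m y)) := by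
  have hc := integral_standardBump_pos (m := m)
  refine tendsto_order.2 ⟨fun a ha ↦ ?_, fun b hb ↦ ?_⟩
  · filter_upwards [eventually_surface_integral_bounds hT hd hΩ hx₀ one_lt_two] with ε h1
    exact ha.trans_le h1.1
  · obtain ⟨θ, h1, h2⟩ := exists_between ((one_lt_div hc).2 hb)
    filter_upwards [eventually_surface_integral_bounds hT hd hΩ hx₀ h1] with ε h3
    exact h3.2.trans_lt ((lt_div_iff₀ hc).1 h2)

/-- The boundary term of the weak equation, tested at scale `ε` at a boundary point. -/
theorem tendsto_boundary_rescaled (hT : IsNormalCoordinates N T)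
    (hd : IsDefiningFunction Ω x₀ N h r) (hΩ : IsOpen Ω) (hΩb : Bornology.IsBounded Ω)
    [IsFiniteMeasure (surfaceMeasure Ω)] (hx₀ : x₀ ∈ frontier Ω)
    {k : E (m + 1) → ℝ} (hk : ContinuousOn k (frontier Ω)) :
    Tendsto (fun ε : ℝ ↦ (ε ^ m)⁻¹ *
        ∫ x, k x * rescaled (boundaryTest T) x₀ ε x ∂(surfaceMeasure Ω))
      (𝓝[>] 0) (𝓝 (k x₀ * ∫ y, standardBump m y)) := by
  have hKf : IsCompact (frontier Ω) :=
    hΩb.isCompact_closure.of_isClosed_subset isClosed_frontier frontier_subset_closure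
  have haef : ∀ᵐ x ∂(surfaceMeasure Ω), x ∈ frontier Ω :=
    ae_restrict_mem isClosed_frontier.measurableSet
  have hφ : ∀ ε, Continuous (rescaled (boundaryTest T) x₀ ε) := fun ε ↦
    (contDiff_rescaled (contDiff_boundaryTest T) x₀ ε).continuous
  have hJ := tendsto_surface_rescaled hT hd hΩ hx₀
  set J : ℝ → ℝ := fun ε ↦
    (ε ^ m)⁻¹ * ∫ x, rescaled (boundaryTest T) x₀ ε x ∂(surfaceMeasure Ω)
  have hi : ∀ ε, Integrable (rescaled (boundaryTest T) x₀ ε) (surfaceMeasure Ω) := fun ε ↦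
    integrable_of_continuousOn_of_ae_mem hKf haef (hφ ε).continuousOn
  have hik : ∀ ε, Integrable (fun x ↦ k x * rescaled (boundaryTest T) x₀ ε x)
      (surfaceMeasure Ω) := fun ε ↦
    integrable_of_continuousOn_of_ae_mem hKf haef (hk.mul (hφ ε).continuousOn)
  have hclose : ∀ η > 0, ∀ᶠ ε : ℝ in 𝓝[>] 0,
      |(ε ^ m)⁻¹ * (∫ x, k x * rescaled (boundaryTest T) x₀ ε x ∂(surfaceMeasure Ω)) -
        k x₀ * J ε| ≤ η * J ε := by
    intro η hη
    obtain ⟨δ, hδ0, hδ⟩ := Metric.continuousWithinAt_iff.1 (hk x₀ hx₀) η hη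
    have hlt : ∀ᶠ ε : ℝ in 𝓝[>] 0, ε < δ / 6 :=
      (eventually_lt_nhds (by positivity)).filter_mono nhdsWithin_le_nhds
    filter_upwards [hlt, self_mem_nhdsWithin] with ε hεδ hε
    rw [mem_Ioi] at hε
    have hεm : 0 ≤ (ε ^ m)⁻¹ := (inv_pos.2 (pow_pos hε m)).le
    have h1 : (ε ^ m)⁻¹ * (∫ x, k x * rescaled (boundaryTest T) x₀ ε x ∂(surfaceMeasure Ω)) -
        k x₀ * J ε = (ε ^ m)⁻¹ * ∫ x, (k x - k x₀) * rescaled (boundaryTest T) x₀ ε x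
          ∂(surfaceMeasure Ω) := by
      simp only [sub_mul, J]
      rw [integral_sub (hik ε) ((hi ε).const_mul _), integral_const_mul]
      ring
    have h2 : ‖∫ x, (k x - k x₀) * rescaled (boundaryTest T) x₀ ε x ∂(surfaceMeasure Ω)‖ ≤
        ∫ x, η * rescaled (boundaryTest T) x₀ ε x ∂(surfaceMeasure Ω) := by
      refine norm_integral_le_of_norm_le ((hi ε).const_mul η) (haef.mono fun x hx ↦ ?_)
      have hnn : 0 ≤ rescaled (boundaryTest T) x₀ ε x := boundaryTest_nonneg T _
      rw [norm_mul, Real.norm_of_nonneg hnn]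
      by_cases hxb : x ∈ ball x₀ δ
      · exact mul_le_mul_of_nonneg_right (dist_eq_norm (k x) (k x₀) ▸ (hδ hx hxb).le) hnn
      · rw [rescaled_boundaryTest_eq_zero hT hε (by linarith) hxb, mul_zero, mul_zero]
    rw [h1, abs_mul, abs_of_nonneg hεm]
    rw [integral_const_mul, Real.norm_eq_abs] at h2
    calc _ ≤ _ := mul_le_mul_of_nonneg_left h2 hεm
      _ = _ := by simp only [J]; ring
  have hdiff : Tendsto (fun ε : ℝ ↦ (ε ^ m)⁻¹ *
      (∫ x, k x * rescaled (boundaryTest T) x₀ ε x ∂(surfaceMeasure Ω)) - k x₀ * J ε)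
      (𝓝[>] 0) (𝓝 0) := by
    have hc := integral_standardBump_pos (m := m)
    refine Metric.tendsto_nhds.2 fun η hη ↦ ?_
    set c := ∫ y, standardBump m y
    filter_upwards [hclose (η / (2 * c)) (by positivity),
      hJ.eventually_lt_const (by linarith : c < 2 * c)] with ε h1 h2
    rw [Real.dist_eq, sub_zero]
    refine h1.trans_lt ?_
    calc η / (2 * c) * J ε < η / (2 * c) * (2 * c) :=
          mul_lt_mul_of_pos_left h2 (by positivity)
      _ = η := by field_simp
  simpa using hdiff.add (hJ.const_mul (k x₀))

/-- If continuous data satisfy the weak equation against all test functions, not necessarily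
vanishing on the boundary, then the normal component of the field is the boundary datum. -/
theorem inner_normal_eq_of_weak {Ω : Set (E (m + 1))} (hΩo : IsOpen Ω)
    (hΩb : Bornology.IsBounded Ω) [IsFiniteMeasure (surfaceMeasure Ω)]
    {f k : E (m + 1) → ℝ} {W : E (m + 1) → E (m + 1)} (hf : ContinuousOn f (closure Ω))
    (hW : ContinuousOn W (closure Ω)) (hk : ContinuousOn k (frontier Ω))
    (hweak : ∀ φ : E (m + 1) → ℝ, ContDiff ℝ 1 φ →
      ∫ x in Ω, (f x * φ x + fderiv ℝ φ x (W x)) = ∫ x, k x * φ x ∂(surfaceMeasure Ω))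
    {x₀ N : E (m + 1)} (hx₀ : x₀ ∈ frontier Ω) (hN : IsOutwardUnitNormal Ω x₀ N) :
    inner ℝ N (W x₀) = k x₀ := by
  obtain ⟨h, r, hd⟩ := hN.exists_isDefiningFunction hΩo hx₀
  obtain ⟨T, hT⟩ := exists_isNormalCoordinates hd.norm_eq_one
  have h1 := tendsto_interior_rescaled hT hd hΩo hΩb hx₀ hf hW
  have h2 := tendsto_boundary_rescaled hT hd hΩo hΩb hx₀ hk
  simp only [hweak _ (contDiff_rescaled (contDiff_boundaryTest T) x₀ _)] at h1
  exact mul_right_cancel₀ integral_standardBump_pos.ne' (tendsto_nhds_unique h1 h2)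

end BoundaryTerm

/-! ### From the weak to the classical equation -/

section Interior

variable {n : ℕ} {Ω : Set (E n)} {f : E n → ℝ} {W : E n → E n}

/-- The weak form `∫_Ω (f φ + Dφ(W)) = 0` of the equation `div W = f`, tested with `C¹` functions of
compact support in `Ω`. -/
def IsWeakSolution (Ω : Set (E n)) (f : E n → ℝ) (W : E n → E n) : Prop :=
  ∀ φ : E n → ℝ, ContDiff ℝ 1 φ → HasCompactSupport φ → tsupport φ ⊆ Ω →
    ∫ x in Ω, (f x * φ x + fderiv ℝ φ x (W x)) = 0

theorem integrable_of_continuousOn_of_eq_zero {K : Set (E n)} (hK : IsCompact K) {H : E n → ℝ}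
    (hH : ContinuousOn H K) (h0 : ∀ x ∉ K, H x = 0) : Integrable H :=
  (integrableOn_iff_integrable_of_support_subset fun x hx ↦ by
    by_contra hxK
    exact hx (h0 x hxK)).1 (hH.integrableOn_compact hK)

theorem fderiv_eq_zero_of_notMem_tsupport {φ : E n → ℝ} {x : E n} (hx : x ∉ tsupport φ) :
    fderiv ℝ φ x = 0 :=
  image_eq_zero_of_notMem_tsupport fun h ↦ hx (tsupport_fderiv_subset ℝ h)

theorem clm_apply_eq_sum (L : E n →L[ℝ] ℝ) (v : E n) :
    L v = ∑ i, v i * L (EuclideanSpace.single i 1) := by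
  conv_lhs => rw [← (EuclideanSpace.basisFun (Fin n) ℝ).sum_repr v, map_sum]
  simp

theorem IsWeakSolution.weakDivEq (h : IsWeakSolution Ω f W) (hf : ContinuousOn f Ω)
    (hW : ContinuousOn W Ω) : WeakDivEq Ω W f := by
  intro φ hφ hφc hφΩ
  have h1 := h φ hφ hφc hφΩ
  have hi1 : Integrable (fun x ↦ f x * φ x) :=
    integrable_of_continuousOn_of_eq_zero hφc
      ((hf.mono hφΩ).mul hφ.continuous.continuousOn) fun x hx ↦ by
        rw [image_eq_zero_of_notMem_tsupport hx, mul_zero]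
  have hi2 : Integrable (fun x ↦ fderiv ℝ φ x (W x)) :=
    integrable_of_continuousOn_of_eq_zero hφc
      ((hφ.continuous_fderiv (by simp)).continuousOn.clm_apply (hW.mono hφΩ)) fun x hx ↦ by
        rw [fderiv_eq_zero_of_notMem_tsupport hx, zero_apply]
  rw [integral_add hi1.integrableOn hi2.integrableOn] at h1
  have h2 : ∀ x, ∑ i, W x i * (∇ φ x) i = fderiv ℝ φ x (W x) := fun x ↦ by
    rw [← inner_gradient, PiLp.inner_apply]
    simp
  simp only [h2]
  linarith

theorem integral_fderiv_linear {ψ : E n → ℝ} (hψ : ContDiff ℝ 1 ψ) (hψc : HasCompactSupport ψ)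
    (L : E n →L[ℝ] E n) :
    ∫ y, fderiv ℝ ψ y (L y) = -(∑ i, L (EuclideanSpace.single i 1) i) * ∫ y, ψ y := by
  have hLi : ∀ i, HasCompactSupport fun y ↦ fderiv ℝ ψ y (EuclideanSpace.single i 1) :=
    fun i ↦ hψc.fderiv_apply ℝ _
  have hLc : ∀ i, Continuous fun y ↦ fderiv ℝ ψ y (EuclideanSpace.single i 1) := fun i ↦
    (hψ.continuous_fderiv (by simp)).clm_apply continuous_const
  have hlin : ∀ i, Continuous fun y : E n ↦ L y i := fun i ↦ by fun_prop
  have hint : ∀ i, Integrable fun y ↦ L y i * fderiv ℝ ψ y (EuclideanSpace.single i 1) := fun i ↦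
    ((hlin i).mul (hLc i)).integrable_of_hasCompactSupport (hLi i).mul_left
  simp only [fun y ↦ clm_apply_eq_sum (fderiv ℝ ψ y) (L y)]
  rw [integral_finsetSum _ fun i _ ↦ hint i, neg_mul, Finset.sum_mul, ← Finset.sum_neg_distrib]
  refine Finset.sum_congr rfl fun i _ ↦ ?_
  have hd : ∀ y, HasFDerivAt (fun y : E n ↦ L y i) ((EuclideanSpace.proj i).comp L) y := fun y ↦
    ((EuclideanSpace.proj i : E n →L[ℝ] ℝ).comp L).hasFDerivAt
  have hfd : ∀ y, fderiv ℝ (fun y : E n ↦ L y i) y (EuclideanSpace.single i 1) =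
      L (EuclideanSpace.single i 1) i := fun y ↦ by rw [(hd y).fderiv]; rfl
  rw [integral_mul_fderiv_eq_neg_fderiv_mul_of_integrable]
  · simp only [hfd, integral_const_mul]
  · simp only [hfd]
    exact (hψ.continuous.integrable_of_hasCompactSupport hψc).const_mul _
  · exact hint i
  · exact ((hlin i).mul hψ.continuous).integrable_of_hasCompactSupport hψc.mul_left
  · exact fun y _ ↦ (hd y).differentiableAt
  · exact fun y _ ↦ hψ.differentiable (by simp) y

theorem integrable_clm_apply {X : Type*} [NormedAddCommGroup X] [NormedSpace ℝ X]
    {k : E n → X →L[ℝ] ℝ} (hk : Continuous k) (hkc : HasCompactSupport k) {G : E n → X} {C : ℝ}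
    (hm : AEStronglyMeasurable G volume) (hb : ∀ y ∈ tsupport k, ‖G y‖ ≤ C) :
    Integrable fun y ↦ k y (G y) := by
  refine ((hk.norm.integrable_of_hasCompactSupport hkc.norm).mul_const C).mono'
    ((ContinuousLinearMap.apply ℝ ℝ).flip.aestronglyMeasurable_comp₂ hk.aestronglyMeasurable hm)
    (ae_of_all _ fun y ↦ ?_)
  by_cases hy : y ∈ tsupport k
  · exact (k y).le_of_opNorm_le_of_le le_rfl (hb y hy)
  · simp [image_eq_zero_of_notMem_tsupport hy]

/-- At a point where the field is differentiable, a weak solution solves the equation: tested with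
a bump function at scale `ε`, the weak form becomes that of the linearised field. -/
theorem IsWeakSolution.sum_diagPartial_eq (h : IsWeakSolution Ω f W) (hΩ : IsOpen Ω)
    (hf : ContinuousOn f Ω) (hW : ContinuousOn W Ω) {x : E n} (hx : x ∈ Ω)
    (hd : DifferentiableAt ℝ W x) : ∑ i, diagPartial W i x = f x := by
  set L := fderiv ℝ W x
  have hL : HasFDerivAt W L x := hd.hasFDerivAt
  have hdiag : ∀ i, diagPartial W i x = L (EuclideanSpace.single i 1) i := fun i ↦ by
    have h1 : HasFDerivAt (fun y ↦ W y i)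
        ((EuclideanSpace.proj i : E n →L[ℝ] ℝ).comp L) x :=
      (EuclideanSpace.proj i : E n →L[ℝ] ℝ).hasFDerivAt.comp x hL
    exact (h1.hasLineDerivAt _).lineDeriv
  simp only [hdiag]
  let ψ : E n → ℝ := fun y ↦ standardBump n y
  have hψ : ContDiff ℝ 1 ψ := (standardBump n).contDiff
  have hψc : HasCompactSupport ψ := (standardBump n).hasCompactSupport
  have hψt : tsupport ψ = closedBall 0 2 := (standardBump n).tsupport_eq
  have hkt : ∀ y ∈ tsupport (testForm ψ), ‖y‖ ≤ 2 := fun y hy ↦ by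
    simpa [hψt] using tsupport_testForm_subset ψ hy
  obtain ⟨C, hC⟩ := hL.isBigO_sub.bound
  have hfx : ContinuousAt f x := hf.continuousAt (hΩ.mem_nhds hx)
  obtain ⟨δ, hδ0, hδ⟩ := Metric.eventually_nhds_iff_ball.1
    (hC.and ((hfx.norm.eventually_lt_const (lt_add_one ‖f x‖)).and (hΩ.mem_nhds hx)))
  have hC0 : 0 ≤ |C| := abs_nonneg C
  have hsmall : ∀ᶠ ε : ℝ in 𝓝[>] 0, 0 < ε ∧ ε < δ / 2 := by
    have hlt : ∀ᶠ ε : ℝ in 𝓝[>] 0, ε < δ / 2 :=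
      (eventually_lt_nhds (by positivity)).filter_mono nhdsWithin_le_nhds
    filter_upwards [hlt, self_mem_nhdsWithin] with ε h1 h2 using ⟨h2, h1⟩
  have hball : ∀ ε : ℝ, 0 < ε ∧ ε < δ / 2 → ∀ y : E n, ‖y‖ ≤ 2 → x + ε • y ∈ ball x δ := by
    intro ε hε y hy
    rw [mem_ball_iff_norm, add_sub_cancel_left, norm_smul, Real.norm_of_nonneg hε.1.le]
    have := mul_le_mul_of_nonneg_left hy hε.1.le
    linarith [hε.2]
  let G : ℝ → E n → ℝ × E n := fun ε y ↦
    (Ω.indicator f (x + ε • y), ε⁻¹ • (Ω.indicator W (x + ε • y) - W x))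
  have hGm : ∀ ε, AEStronglyMeasurable (G ε) volume := fun ε ↦
    (aestronglyMeasurable_indicator_comp hΩ.measurableSet hf x).prodMk
      (((aestronglyMeasurable_indicator_comp hΩ.measurableSet hW x).sub
        aestronglyMeasurable_const).const_smul ε⁻¹)
  have hGb : ∀ ε : ℝ, 0 < ε ∧ ε < δ / 2 → ∀ y ∈ tsupport (testForm ψ),
      ‖G ε y‖ ≤ max (‖f x‖ + 1) (|C| * 2) := by
    intro ε hε y hy
    obtain ⟨h1, h2, h3⟩ := hδ _ (hball ε hε y (hkt y hy))
    simp only [G, indicator_of_mem h3, Prod.norm_def]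
    refine max_le_max h2.le ?_
    rw [add_sub_cancel_left, norm_smul, Real.norm_of_nonneg hε.1.le] at h1
    rw [norm_smul, norm_inv, Real.norm_of_nonneg hε.1.le, inv_mul_le_iff₀ hε.1]
    calc _ ≤ _ := h1
      _ ≤ |C| * (ε * ‖y‖) :=
        mul_le_mul_of_nonneg_right (le_abs_self C) (mul_nonneg hε.1.le (norm_nonneg y))
      _ ≤ |C| * (ε * 2) := by have := hkt y hy; have := hε.1.le; gcongr
      _ = _ := by ring
  have hlim := tendsto_integral_clm_apply (continuous_testForm hψ)
    (hasCompactSupport_testForm hψc) (G := G) (G₀ := fun y ↦ (f x, L y))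
    (Eventually.of_forall hGm) (hsmall.mono hGb) (ae_of_all _ fun y ↦ ?_)
  · have hzero : ∀ᶠ ε in 𝓝[>] 0, ∫ y, testForm ψ y (G ε y) = 0 := by
      filter_upwards [hsmall] with ε hε
      have hsupp : tsupport (rescaled ψ x ε) ⊆ closedBall x (2 * ε) := by
        refine closure_minimal (fun z hz ↦ ?_) isClosed_closedBall
        have : ε⁻¹ • (z - x) ∈ tsupport ψ := subset_tsupport ψ hz
        rw [hψt, mem_closedBall_zero_iff, norm_smul, norm_inv, Real.norm_of_nonneg hε.1.le,
          inv_mul_le_iff₀ hε.1] at this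
        rw [mem_closedBall_iff_norm]
        linarith
      have h1 := h (rescaled ψ x ε) (contDiff_rescaled hψ x ε)
        ((isCompact_closedBall x (2 * ε)).of_isClosed_subset (isClosed_tsupport _) hsupp)
        (fun z hz ↦ (hδ z (closedBall_subset_ball (by linarith [hε.2]) (hsupp hz))).2.2)
      rw [setIntegral_rescaled hΩ.measurableSet hψ f W x hε.1, mul_eq_zero] at h1
      replace h1 := h1.resolve_left (pow_ne_zero n hε.1.ne')
      -- Subtracting the constant `W x` from the field changes nothing, as `∫ Dψ = 0`.
      have h2 : ∫ y, testForm ψ y (0, ε⁻¹ • W x) = 0 := by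
        simp only [testForm_apply, mul_zero, zero_add]
        exact integral_fderiv_apply_eq_zero hψ hψc _
      have h3 : ∀ y, testForm ψ y (Ω.indicator f (x + ε • y), ε⁻¹ • Ω.indicator W (x + ε • y)) =
          testForm ψ y (G ε y) + testForm ψ y (0, ε⁻¹ • W x) := fun y ↦ by
        rw [← map_add]
        simp only [G, Prod.mk_add_mk, add_zero, smul_sub, sub_add_cancel]
      simp only [h3] at h1
      rw [integral_add (integrable_clm_apply (continuous_testForm hψ)
        (hasCompactSupport_testForm hψc) (hGm ε) (hGb ε hε))
        (integrable_clm_apply (continuous_testForm hψ) (hasCompactSupport_testForm hψc)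
          (G := fun _ ↦ (0, ε⁻¹ • W x)) aestronglyMeasurable_const (fun y _ ↦ le_rfl)), h2,
        add_zero] at h1
      exact h1
    have h0 := tendsto_nhds_unique hlim (tendsto_const_nhds.congr'
      (hzero.mono fun ε hε ↦ hε.symm))
    simp only [testForm_apply] at h0
    rw [integral_add ((hψ.continuous.integrable_of_hasCompactSupport hψc).mul_const _)
      (((hψ.continuous_fderiv (by simp)).clm_apply
        L.continuous).integrable_of_hasCompactSupport ?_), integral_mul_const,
      integral_fderiv_linear hψ hψc] at h0
    · have hpos : 0 < ∫ y, ψ y := integral_standardBump_pos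
      have h1 : (f x - ∑ i, L (EuclideanSpace.single i 1) i) * ∫ y, ψ y = 0 := by linarith
      linarith [(mul_eq_zero.1 h1).resolve_right hpos.ne']
    · refine HasCompactSupport.intro hψc fun y hy ↦ ?_
      rw [fderiv_eq_zero_of_notMem_tsupport hy, zero_apply]
  · have hline : Tendsto (fun ε : ℝ ↦ x + ε • y) (𝓝[>] 0) (𝓝 x) := by
      have : Tendsto (fun ε : ℝ ↦ x + ε • y) (𝓝 0) (𝓝 (x + (0 : ℝ) • y)) :=
        Continuous.tendsto (by fun_prop) 0
      rw [zero_smul, add_zero] at this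
      exact this.mono_left nhdsWithin_le_nhds
    have hmem : ∀ᶠ ε : ℝ in 𝓝[>] 0, x + ε • y ∈ Ω := hline.eventually (hΩ.mem_nhds hx)
    refine Tendsto.prodMk_nhds ?_ ?_
    · refine (hfx.tendsto.comp hline).congr' ?_
      filter_upwards [hmem] with ε hε
      rw [indicator_of_mem hε, Function.comp_apply]
    · have h1 : HasLineDerivAt ℝ W (L y) x y := hL.hasLineDerivAt y
      refine (hasDerivAt_iff_tendsto_slope_zero.1 h1 |>.mono_left
        (nhdsWithin_mono _ fun ε hε ↦ ne_of_gt hε)).congr' ?_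
      filter_upwards [hmem] with ε hε
      simp [indicator_of_mem hε]

/-- Where the diagonal partial derivatives of the field exist and are continuous, they may be
integrated by parts along lines, and the fundamental lemma of the calculus of variations gives
the equation. -/
theorem IsWeakSolution.sum_diagPartial_eq_of_hasContDiagPartialsOn (h : IsWeakSolution Ω f W)
    (hf : ContinuousOn f Ω) (hW : ContinuousOn W Ω) {U : Set (E n)}
    (hUΩ : U ⊆ Ω) (hU : IsOpen U) (hpart : HasContDiagPartialsOn W U) {x : E n} (hx : x ∈ U) :
    ∑ i, diagPartial W i x = f x := by
  have hdivc : ContinuousOn (fun y ↦ ∑ i, diagPartial W i y) U :=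
    continuousOn_finsetSum _ fun i _ ↦ (hpart i).2
  have hWi : ∀ i, ContinuousOn (fun y ↦ W y i) Ω := fun i ↦
    (EuclideanSpace.proj i : E n →L[ℝ] ℝ).continuous.comp_continuousOn hW
  have hae : ∀ᵐ y, y ∈ U → (∑ i, diagPartial W i y) - f y = 0 := by
    refine hU.ae_eq_zero_of_integral_contDiff_smul_eq_zero
      ((hdivc.sub (hf.mono hUΩ)).locallyIntegrableOn hU.measurableSet) fun φ hφ hφc hφU ↦ ?_
    have hφ1 : ContDiff ℝ 1 φ := hφ.of_le (by exact_mod_cast le_top)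
    have hφd : Continuous (fderiv ℝ φ) := hφ1.continuous_fderiv (by simp)
    have hi : ∀ H : E n → ℝ, ContinuousOn H U → (∀ y ∉ tsupport φ, H y = 0) → Integrable H :=
      fun H hH h0 ↦ integrable_of_continuousOn_of_eq_zero hφc (hH.mono hφU) h0
    have hvan : ∀ y ∉ tsupport φ, φ y = 0 := fun y hy ↦ image_eq_zero_of_notMem_tsupport hy
    have hparts : ∀ i, ∫ y, (diagPartial W i y * φ y +
        W y i * fderiv ℝ φ y (EuclideanSpace.single i 1)) = 0 := by
      intro i
      refine integral_lineDeriv_eq_zero (f := fun y ↦ W y i * φ y)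
        (v := EuclideanSpace.single i 1) ?_ ?_ fun y ↦ ?_
      · exact hi _ (((hWi i).mono hUΩ).mul hφ1.continuous.continuousOn) fun y hy ↦ by
          rw [hvan y hy, mul_zero]
      · exact hi _ (((hpart i).2.mul hφ1.continuous.continuousOn).add
          (((hWi i).mono hUΩ).mul (hφd.clm_apply continuous_const).continuousOn)) fun y hy ↦ by
          rw [hvan y hy, fderiv_eq_zero_of_notMem_tsupport hy, zero_apply, mul_zero, mul_zero,
            add_zero]
      · by_cases hy : y ∈ tsupport φ
        · have h1 : HasLineDerivAt ℝ (fun y ↦ W y i) (diagPartial W i y) y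
              (EuclideanSpace.single i 1) := ((hpart i).1 y (hφU hy)).hasLineDerivAt
          have h2 : HasLineDerivAt ℝ φ (fderiv ℝ φ y (EuclideanSpace.single i 1)) y
              (EuclideanSpace.single i 1) :=
            (hφ1.differentiable (by simp) y).hasFDerivAt.hasLineDerivAt _
          simpa [HasLineDerivAt] using HasDerivAt.fun_mul h1 h2
        · rw [hvan y hy, fderiv_eq_zero_of_notMem_tsupport hy, zero_apply, mul_zero, mul_zero,
            add_zero]
          have h1 : HasFDerivAt (fun y ↦ W y i * φ y) (0 : E n →L[ℝ] ℝ) y := by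
            refine (hasFDerivAt_const (0 : ℝ) y).congr_of_eventuallyEq ?_
            filter_upwards [(isClosed_tsupport φ).isOpen_compl.mem_nhds hy] with z hz
            rw [hvan z hz, mul_zero]
          simpa using h1.hasLineDerivAt (EuclideanSpace.single i 1)
    have hI1 : Integrable fun y ↦ (∑ i, diagPartial W i y) * φ y :=
      hi _ (hdivc.mul hφ1.continuous.continuousOn) fun y hy ↦ by rw [hvan y hy, mul_zero]
    have hI2 : Integrable fun y ↦ fderiv ℝ φ y (W y) :=
      hi _ (hφd.continuousOn.clm_apply (hW.mono hUΩ)) fun y hy ↦ by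
        rw [fderiv_eq_zero_of_notMem_tsupport hy, zero_apply]
    have hI3 : Integrable fun y ↦ f y * φ y :=
      hi _ ((hf.mono hUΩ).mul hφ1.continuous.continuousOn) fun y hy ↦ by rw [hvan y hy, mul_zero]
    have hdiv : ∫ y, ((∑ i, diagPartial W i y) * φ y + fderiv ℝ φ y (W y)) = 0 := by
      have h1 : ∀ y, (∑ i, diagPartial W i y) * φ y + fderiv ℝ φ y (W y) =
          ∑ i, (diagPartial W i y * φ y +
            W y i * fderiv ℝ φ y (EuclideanSpace.single i 1)) := fun y ↦ by
        rw [clm_apply_eq_sum (fderiv ℝ φ y), Finset.sum_add_distrib, Finset.sum_mul]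
      simp only [h1]
      rw [integral_finsetSum _ fun i _ ↦ ?_]
      · exact Finset.sum_eq_zero fun i _ ↦ hparts i
      · exact hi _ (((hpart i).2.mul hφ1.continuous.continuousOn).add
          (((hWi i).mono hUΩ).mul (hφd.clm_apply continuous_const).continuousOn)) fun y hy ↦ by
          rw [hvan y hy, fderiv_eq_zero_of_notMem_tsupport hy, zero_apply, mul_zero, mul_zero,
            add_zero]
    have hweak := h φ hφ1 hφc (hφU.trans hUΩ)
    rw [setIntegral_eq_integral_of_forall_compl_eq_zero fun y hy ↦ ?_] at hweak
    · rw [integral_add hI1 hI2] at hdiv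
      rw [integral_add hI3 hI2] at hweak
      have h1 : ∀ y, φ y • ((∑ i, diagPartial W i y) - f y) =
          (∑ i, diagPartial W i y) * φ y - f y * φ y := fun y ↦ by rw [smul_eq_mul]; ring
      simp only [h1]
      rw [integral_sub hI1 hI3]
      linarith
    · have hy' : y ∉ tsupport φ := fun h' ↦ hy (hUΩ (hφU h'))
      rw [hvan y hy', fderiv_eq_zero_of_notMem_tsupport hy', zero_apply, mul_zero, add_zero]
  have hEq := Measure.eqOn_open_of_ae_eq (μ := volume) (U := U)
    (f := fun y ↦ ∑ i, diagPartial W i y) (g := f)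
    ((ae_restrict_iff' hU.measurableSet).2 (hae.mono fun y hy hyU ↦ sub_eq_zero.1 (hy hyU)))
    hU hdivc (hf.mono hUΩ)
  exact hEq hx

end Interior

/-! ### Regularity of the field -/

section Regularity

variable {n : ℕ} {Ω : Set (E n)} {F : E n × ℝ × E n → ℝ} {u : E n → ℝ}

theorem differentiableOn_Fgrad_of_contDiffOn (hΩ : IsOpen Ω)
    (hF : ContDiffOn ℝ 2 F (closure Ω ×ˢ univ)) (hu : ContDiffOn ℝ 2 u Ω) :
    DifferentiableOn ℝ (Fgrad Ω F u) Ω := by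
  have hO : IsOpen (Ω ×ˢ (univ : Set (ℝ × E n))) := hΩ.prod isOpen_univ
  have hF' : ContDiffOn ℝ 2 F (Ω ×ˢ univ) := hF.mono (prod_mono_left subset_closure)
  have hdF : ContDiffOn ℝ 1 (fderiv ℝ F) (Ω ×ˢ univ) :=
    hF'.fderiv_of_isOpen hO (by norm_num)
  have hdu : ContDiffOn ℝ 1 (fderiv ℝ u) Ω := hu.fderiv_of_isOpen hΩ (by norm_num)
  have hgrad : ∀ x ∈ Ω, grad Ω u x = (InnerProductSpace.toDual ℝ (E n)).symm (fderiv ℝ u x) := by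
    intro x hx
    rw [grad, gradientWithin, fderivWithin_of_mem_nhds
      (mem_of_superset (hΩ.mem_nhds hx) subset_closure)]
  have hdual : Differentiable ℝ (InnerProductSpace.toDual ℝ (E n)).symm :=
    (InnerProductSpace.toDual ℝ (E n)).symm.toContinuousLinearEquiv.differentiable
  have hdgrad : DifferentiableOn ℝ (grad Ω u) Ω :=
    (hdual.comp_differentiableOn (hdu.differentiableOn (by simp))).congr hgrad
  have hslice : ∀ x ∈ Ω, Fgrad Ω F u x = (InnerProductSpace.toDual ℝ (E n)).symm
      (((fderiv ℝ F (x, u x, grad Ω u x)).comp (ContinuousLinearMap.inr ℝ (E n) (ℝ × E n))).comp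
        (ContinuousLinearMap.inr ℝ ℝ (E n))) := by
    intro x hx
    rw [Fgrad_eq (hF.of_le (by norm_num)) (subset_closure hx)]
    have h1 : HasFDerivAt F (fderiv ℝ F (x, u x, grad Ω u x)) (x, u x, grad Ω u x) :=
      ((hF'.differentiableOn (by norm_num)).differentiableAt
        (hO.mem_nhds ⟨hx, mem_univ _⟩)).hasFDerivAt
    have h2 : HasFDerivAt (fun y : ℝ × E n ↦ (x, y)) (ContinuousLinearMap.inr ℝ (E n) (ℝ × E n))
        (u x, grad Ω u x) := hasFDerivAt_prodMk_right _ _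
    have h3 := (h1.comp (u x, grad Ω u x) h2).fderiv
    rw [← h3]
    rfl
  refine DifferentiableOn.congr ?_ hslice
  refine hdual.comp_differentiableOn ?_
  have h4 : DifferentiableOn ℝ (fun x ↦ fderiv ℝ F (x, u x, grad Ω u x)) Ω :=
    (hdF.differentiableOn (by simp)).comp (f := fun x ↦ (x, u x, grad Ω u x))
      (differentiableOn_id.prodMk ((hu.differentiableOn (by norm_num)).prodMk hdgrad))
      (fun x hx ↦ ⟨hx, mem_univ _⟩)
  exact (h4.clm_comp (differentiableOn_const _)).clm_comp (differentiableOn_const _)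

/-- The lemma of du Bois-Reymond: in one dimension, a continuous function with continuous weak
derivative `f` has classical derivative `f`. Subtracting a primitive of `f` leaves a function that
is orthogonal to all functions of mean zero, hence constant. -/
theorem hasDerivAt_of_weak {w f : ℝ → ℝ} {I : Set ℝ} (hI : IsOpen I) (hw : ContinuousOn w I)
    (hf : ContinuousOn f I) (hweak : ∀ φ : ℝ → ℝ, ContDiff ℝ 1 φ → HasCompactSupport φ →
      tsupport φ ⊆ I → ∫ s in I, (f s * φ s + deriv φ s * w s) = 0) {t : ℝ} (ht : t ∈ I) :
    HasDerivAt w (f t) t := by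
  obtain ⟨ε, hε, hball⟩ := Metric.isOpen_iff.1 hI t ht
  set α := t - ε / 2 with hα
  set β := t + ε / 2 with hβ
  have hαβ : α ≤ β := by linarith
  have hsub : Icc α β ⊆ I := fun s hs ↦ hball (by
    rw [mem_ball, Real.dist_eq, abs_lt]; constructor <;> linarith [hs.1, hs.2])
  let f' : ℝ → ℝ := fun s ↦ f (projIcc α β hαβ s)
  have hf'c : Continuous f' :=
    (continuousOn_iff_continuous_domRestrict.1 (hf.mono hsub)).comp continuous_projIcc
  have hf'eq : ∀ s ∈ Icc α β, f' s = f s := fun s hs ↦ by simp only [f', projIcc_of_mem hαβ hs]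
  let G : ℝ → ℝ := fun s ↦ ∫ σ in α..s, f' σ
  have hG : ∀ s, HasDerivAt G (f' s) s := fun s ↦
    intervalIntegral.integral_hasDerivAt_right (hf'c.intervalIntegrable _ _)
      hf'c.stronglyMeasurable.stronglyMeasurableAtFilter hf'c.continuousAt
  have hGc : Continuous G := continuous_iff_continuousAt.2 fun s ↦ (hG s).continuousAt
  have hwc : ContinuousOn w (uIcc α β) := by rw [uIcc_of_le hαβ]; exact hw.mono hsub
  have hii : ∀ {H : ℝ → ℝ}, ContinuousOn H (uIcc α β) → IntervalIntegrable H volume α β :=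
    fun h ↦ h.intervalIntegrable
  -- `w - G` is orthogonal to functions of mean zero.
  have key : ∀ ζ : ℝ → ℝ, Continuous ζ → (∀ s ∉ Ioo α β, ζ s = 0) → ∫ s in α..β, ζ s = 0 →
      ∫ s in α..β, (w s - G s) * ζ s = 0 := by
    intro ζ hζ hζ0 hζint
    let φ : ℝ → ℝ := fun s ↦ ∫ σ in α..s, ζ σ
    have hφ : ∀ s, HasDerivAt φ (ζ s) s := fun s ↦
      intervalIntegral.integral_hasDerivAt_right (hζ.intervalIntegrable _ _)
        hζ.stronglyMeasurable.stronglyMeasurableAtFilter hζ.continuousAt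
    have hφd : deriv φ = ζ := funext fun s ↦ (hφ s).deriv
    have hφ1 : ContDiff ℝ 1 φ :=
      contDiff_one_iff_deriv.2 ⟨fun s ↦ (hφ s).differentiableAt, hφd ▸ hζ⟩
    have hφ0 : ∀ s ∉ Icc α β, φ s = 0 := by
      intro s hs
      rcases lt_or_ge s α with h1 | h1
      · have : ∫ σ in α..s, ζ σ = ∫ σ in α..s, (0 : ℝ) :=
          intervalIntegral.integral_congr fun σ hσ ↦ hζ0 σ fun h2 ↦ by
            rw [uIcc_of_ge h1.le] at hσ
            exact absurd h2.1 hσ.2.not_gt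
        simpa [φ] using this
      · have h2 : β < s := not_le.1 fun h3 ↦ hs ⟨h1, h3⟩
        have h3 : ∫ σ in β..s, ζ σ = ∫ σ in β..s, (0 : ℝ) :=
          intervalIntegral.integral_congr fun σ hσ ↦ hζ0 σ fun h4 ↦ by
            rw [uIcc_of_le h2.le] at hσ
            exact absurd h4.2 hσ.1.not_gt
        simp only [φ]
        rw [← intervalIntegral.integral_add_adjacent_intervals (hζ.intervalIntegrable α β)
          (hζ.intervalIntegrable β s), hζint, h3]
        simp
    have hφt : tsupport φ ⊆ Icc α β :=
      closure_minimal (fun s hs ↦ by by_contra h; exact hs (hφ0 s h)) isClosed_Icc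
    have h1 := hweak φ hφ1 (isCompact_Icc.of_isClosed_subset (isClosed_tsupport φ) hφt)
      (hφt.trans hsub)
    rw [setIntegral_eq_of_subset_of_forall_sdiff_eq_zero hI.measurableSet hsub fun s hs ↦ by
      rw [hφ0 s hs.2, hφd, hζ0 s fun h ↦ hs.2 (Ioo_subset_Icc_self h)]; ring,
      integral_Icc_eq_integral_Ioc, ← intervalIntegral.integral_of_le hαβ] at h1
    have h2 : ∫ s in α..β, (f s * φ s + deriv φ s * w s) =
        ∫ s in α..β, (f' s * φ s + w s * ζ s) := intervalIntegral.integral_congr fun s hs ↦ by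
      rw [uIcc_of_le hαβ] at hs
      simp only [hf'eq s hs, hφd]; ring
    have hφc : Continuous φ := hφ1.continuous
    have hi1 : IntervalIntegrable (fun s ↦ f' s * φ s) volume α β :=
      (hf'c.mul hφc).intervalIntegrable _ _
    have hi2 : IntervalIntegrable (fun s ↦ w s * ζ s) volume α β :=
      hii (hwc.mul hζ.continuousOn)
    rw [h2, intervalIntegral.integral_add hi1 hi2] at h1
    have h3 : ∫ s in α..β, G s * ζ s = G β * φ β - G α * φ α - ∫ s in α..β, f' s * φ s :=
      intervalIntegral.integral_mul_deriv_eq_deriv_mul (fun s _ ↦ hG s) (fun s _ ↦ hφ s)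
        (hf'c.intervalIntegrable _ _) (hζ.intervalIntegrable _ _)
    have h4 : φ α = 0 := by simp [φ]
    have h5 : φ β = 0 := hζint
    rw [h4, h5] at h3
    simp only [sub_mul]
    have hi3 : IntervalIntegrable (fun s ↦ G s * ζ s) volume α β :=
      (hGc.mul hζ).intervalIntegrable _ _
    rw [intervalIntegral.integral_sub hi2 hi3, h3]
    linarith
  let b : ContDiffBump t := ⟨ε / 8, ε / 4, by positivity, by linarith⟩
  let ρ : ℝ → ℝ := b.normed volume
  have hρc : Continuous ρ := b.continuous_normed
  have hρ0 : ∀ s ∉ Ioo α β, ρ s = 0 := fun s hs ↦ by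
    by_contra h
    have h1 : s ∈ Function.support (b.normed volume) := h
    rw [b.support_normed_eq, mem_ball, Real.dist_eq, abs_lt] at h1
    refine hs ⟨?_, ?_⟩ <;> simp only [b] at h1 <;> linarith [h1.1, h1.2]
  have hinterval : ∀ H : ℝ → ℝ, (∀ s ∉ Ioo α β, H s = 0) → ∫ s, H s = ∫ s in α..β, H s := by
    intro H hH
    rw [intervalIntegral.integral_of_le hαβ, setIntegral_eq_integral_of_forall_compl_eq_zero]
    exact fun s hs ↦ hH s fun h ↦ hs (Ioo_subset_Ioc_self h)
  have hρ1 : ∫ s in α..β, ρ s = 1 := by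
    rw [← hinterval ρ hρ0]; exact b.integral_normed
  set c := ∫ s in α..β, (w s - G s) * ρ s with hc
  have hhc : ContinuousOn (fun s ↦ w s - G s) (uIcc α β) := hwc.sub hGc.continuousOn
  have hIoo : Ioo α β ⊆ uIcc α β := by rw [uIcc_of_le hαβ]; exact Ioo_subset_Icc_self
  have hae : ∀ᵐ s, s ∈ Ioo α β → (w s - G s) - c = 0 := by
    refine isOpen_Ioo.ae_eq_zero_of_integral_contDiff_smul_eq_zero
      (((hhc.mono hIoo).sub continuousOn_const).locallyIntegrableOn measurableSet_Ioo)
      fun η hη _ hηt ↦ ?_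
    have hηc : Continuous η := hη.continuous
    have hη0 : ∀ s ∉ Ioo α β, η s = 0 := fun s hs ↦
      image_eq_zero_of_notMem_tsupport fun h ↦ hs (hηt h)
    set d := ∫ s in α..β, η s
    have h1 := key (fun s ↦ η s - d * ρ s) (hηc.sub (hρc.const_mul d))
      (fun s hs ↦ by rw [hη0 s hs, hρ0 s hs]; ring) (by
        rw [intervalIntegral.integral_sub (hηc.intervalIntegrable _ _)
          ((hρc.const_mul d).intervalIntegrable _ _), intervalIntegral.integral_const_mul, hρ1]
        ring)
    have h2 : ∀ s, (w s - G s) * (η s - d * ρ s) =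
        (w s - G s) * η s - d * ((w s - G s) * ρ s) := fun s ↦ by ring
    simp only [h2] at h1
    have hi1 : IntervalIntegrable (fun s ↦ (w s - G s) * η s) volume α β :=
      hii (hhc.mul hηc.continuousOn)
    have hi2 : IntervalIntegrable (fun s ↦ (w s - G s) * ρ s) volume α β :=
      hii (hhc.mul hρc.continuousOn)
    rw [intervalIntegral.integral_sub hi1 (hi2.const_mul d), intervalIntegral.integral_const_mul,
      ← hc] at h1
    rw [hinterval _ fun s hs ↦ by rw [hη0 s hs, zero_smul]]
    have h3 : ∀ s, η s • (w s - G s - c) = (w s - G s) * η s - c * η s := fun s ↦ by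
      rw [smul_eq_mul]; ring
    simp only [h3]
    rw [intervalIntegral.integral_sub hi1 ((hηc.const_mul c).intervalIntegrable _ _),
      intervalIntegral.integral_const_mul]
    linarith
  have hEq := Measure.eqOn_open_of_ae_eq (μ := volume) (U := Ioo α β)
    (f := fun s ↦ w s - G s) (g := fun _ ↦ c)
    ((ae_restrict_iff' measurableSet_Ioo).2 (hae.mono fun s hs h ↦ sub_eq_zero.1 (hs h)))
    isOpen_Ioo (hhc.mono hIoo) continuousOn_const
  have htm : t ∈ Ioo α β := ⟨by linarith, by linarith⟩
  have h1 : HasDerivAt (fun s ↦ G s + c) (f t) t := by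
    rw [← hf'eq t (Ioo_subset_Icc_self htm)]
    exact (hG t).add_const c
  refine h1.congr_of_eventuallyEq ?_
  filter_upwards [isOpen_Ioo.mem_nhds htm] with s hs
  have := hEq hs
  simp only at this
  linarith

/-- In dimension one a continuous weak solution is differentiable. -/
theorem IsWeakSolution.differentiableOn_of_dim_one {Ω : Set (E 1)} {f : E 1 → ℝ} {W : E 1 → E 1}
    (h : IsWeakSolution Ω f W) (hΩ : IsOpen Ω) (hf : ContinuousOn f Ω) (hW : ContinuousOn W Ω) :
    DifferentiableOn ℝ W Ω := by
  let e : ℝ ≃ₗᵢ[ℝ] E 1 := (OrthonormalBasis.singleton (Fin 1) ℝ).repr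
  have he : MeasurePreserving e := (OrthonormalBasis.singleton (Fin 1) ℝ).measurePreserving_repr
  have hemb : MeasurableEmbedding e := e.toHomeomorph.measurableEmbedding
  have hI : IsOpen (e ⁻¹' Ω) := hΩ.preimage e.continuous
  have hw : ContinuousOn (fun s ↦ e.symm (W (e s))) (e ⁻¹' Ω) :=
    e.symm.continuous.comp_continuousOn
      (hW.comp e.continuous.continuousOn (mapsTo_preimage e Ω))
  have hf' : ContinuousOn (fun s ↦ f (e s)) (e ⁻¹' Ω) :=
    hf.comp e.continuous.continuousOn (mapsTo_preimage e Ω)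
  have hder := fun (s : ℝ) (hs : s ∈ e ⁻¹' Ω) ↦ hasDerivAt_of_weak hI hw hf' (fun φ hφ hφc hφI ↦ by
    have hφe : ContDiff ℝ 1 (φ ∘ e.symm) := hφ.comp e.symm.contDiff
    have hsupp : tsupport (φ ∘ e.symm) = e.symm ⁻¹' tsupport φ :=
      tsupport_comp_eq_preimage φ e.symm.toHomeomorph
    have h1 := h (φ ∘ e.symm) hφe (hφc.comp_homeomorph e.symm.toHomeomorph) (by
      rw [hsupp]
      intro x hx
      simpa using hφI hx)
    rw [← he.setIntegral_preimage_emb hemb] at h1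
    rw [← h1]
    refine setIntegral_congr_fun hI.measurableSet fun s _ ↦ ?_
    have h2 : HasFDerivAt (φ ∘ e.symm) ((fderiv ℝ φ s).comp
        (e.symm.toContinuousLinearEquiv : E 1 →L[ℝ] ℝ)) (e s) := by
      have h3 : HasFDerivAt φ (fderiv ℝ φ s) (e.symm (e s)) := by
        rw [e.symm_apply_apply]
        exact (hφ.differentiable (by simp) s).hasFDerivAt
      exact h3.comp (e s) e.symm.toContinuousLinearEquiv.hasFDerivAt
    simp only [h2.fderiv, Function.comp_apply, e.symm_apply_apply]
    rw [ContinuousLinearMap.comp_apply, fderiv_eq_smul_deriv, smul_eq_mul, mul_comm (deriv φ s)]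
    rfl) hs
  intro x hx
  have h1 : DifferentiableAt ℝ (fun s ↦ e.symm (W (e s))) (e.symm x) :=
    (hder (e.symm x) (by simpa using hx)).differentiableAt
  have h2 : DifferentiableAt ℝ (fun x ↦ e (e.symm (W (e (e.symm x))))) x :=
    e.toContinuousLinearEquiv.differentiableAt.comp x
      (h1.comp x e.symm.toContinuousLinearEquiv.differentiableAt)
  simpa using h2.differentiableWithinAt

end Regularity

end NaturalBC

open NaturalBC in
theorem mainTheorem2 {n : ℕ} (hn : 1 ≤ n)
    (Ω : Set (NaturalBC.E n)) (hΩo : IsOpen Ω) (hΩb : Bornology.IsBounded Ω)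
    (hΩ : NaturalBC.HasC1Boundary Ω)
    (F : NaturalBC.E n × ℝ × NaturalBC.E n → ℝ) (g : NaturalBC.E n × ℝ → ℝ)
    (hF : ContDiffOn ℝ 2 F (closure Ω ×ˢ Set.univ))
    (hg : ContDiffOn ℝ 1 g (frontier Ω ×ˢ Set.univ))
    (V : Set (NaturalBC.E n → ℝ)) (hV : V ⊆ NaturalBC.C1Closure Ω)
    (u : NaturalBC.E n → ℝ)
    (hvar : ∀ φ ∈ NaturalBC.C1Closure Ω, ∃ δ > 0, ∀ τ : ℝ, |τ| < δ → u + τ • φ ∈ V)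
    (hu : NaturalBC.IsLocalMinimizer Ω F g V u) :
    -- the Euler-Lagrange equation in `Ω`, in the sense of distributions
    NaturalBC.WeakDivEq Ω (NaturalBC.Fgrad Ω F u) (NaturalBC.Fv Ω F u) ∧
    -- the equation holds classically wherever the field is differentiable
    (∀ x ∈ Ω, DifferentiableAt ℝ (NaturalBC.Fgrad Ω F u) x →
      ∑ i, NaturalBC.diagPartial (NaturalBC.Fgrad Ω F u) i x = NaturalBC.Fv Ω F u x) ∧
    -- and wherever the partial derivatives in it exist and are continuous
    (∀ U ⊆ Ω, IsOpen U → NaturalBC.HasContDiagPartialsOn (NaturalBC.Fgrad Ω F u) U →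
      ∀ x ∈ U,
        ∑ i, NaturalBC.diagPartial (NaturalBC.Fgrad Ω F u) i x = NaturalBC.Fv Ω F u x) ∧
    -- the field is differentiable in all of `Ω` if `n = 1` or `u` is of class `C²` in `Ω`
    (n = 1 ∨ ContDiffOn ℝ 2 u Ω → DifferentiableOn ℝ (NaturalBC.Fgrad Ω F u) Ω) ∧
    -- the Neumann-type condition holds at every point of `∂Ω`
    (∀ x ∈ frontier Ω, ∀ N : NaturalBC.E n, NaturalBC.IsOutwardUnitNormal Ω x N →
      ∑ i, NaturalBC.Fgrad Ω F u x i * N i = NaturalBC.gv g u x) := by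
  obtain ⟨m, rfl⟩ : ∃ m, n = m + 1 := ⟨n - 1, by omega⟩
  have hUD := hΩ.uniqueDiffOn_closure hΩo
  have := isFiniteMeasure_surfaceMeasure hΩo hΩb hΩ
  have hF1 : ContDiffOn ℝ 1 F (closure Ω ×ˢ Set.univ) := hF.of_le (by norm_num)
  have hu1 : u ∈ C1Closure Ω := hV hu.1
  have hf := continuousOn_Fv hUD hu1 hF1
  have hW := continuousOn_Fgrad hUD hu1 hF1
  have hid : ∀ φ : E (m + 1) → ℝ, ContDiff ℝ 1 φ →
      ∫ x in Ω, (Fv Ω F u x * φ x + fderiv ℝ φ x (Fgrad Ω F u x)) =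
        ∫ x, gv g u x * φ x ∂(surfaceMeasure Ω) := fun φ hφ ↦
    hu.integral_eq_integral_frontier hΩo hΩb hUD hF1 hg hV hvar hφ
  have hweak : IsWeakSolution Ω (Fv Ω F u) (Fgrad Ω F u) := fun φ hφ _ hφΩ ↦ by
    rw [hid φ hφ, surfaceMeasure]
    refine setIntegral_eq_zero_of_forall_eq_zero fun x hx ↦ ?_
    rw [hΩo.frontier_eq] at hx
    rw [image_eq_zero_of_notMem_tsupport (f := φ) fun h ↦ hx.2 (hφΩ h), mul_zero]
  have hfΩ := hf.mono subset_closure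
  have hWΩ := hW.mono subset_closure
  refine ⟨hweak.weakDivEq hfΩ hWΩ,
    fun x hx hd ↦ hweak.sum_diagPartial_eq hΩo hfΩ hWΩ hx hd,
    fun U hUΩ hU hpart x hx ↦
      hweak.sum_diagPartial_eq_of_hasContDiagPartialsOn hfΩ hWΩ hUΩ hU hpart hx, ?_, ?_⟩
  · rintro (h1 | h2)
    · obtain rfl : m = 0 := by omega
      exact hweak.differentiableOn_of_dim_one hΩo hfΩ hWΩ
    · exact differentiableOn_Fgrad_of_contDiffOn hΩo hF h2
  · intro x hx N hN
    rw [← inner_normal_eq_of_weak hΩo hΩb hf hW (continuousOn_gv hu1 hg) hid hx hN,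
      PiLp.inner_apply]
    simp
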